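/- Let $V$ be a complex Hilbert space, with inner product $\langle\cdot\,|\,\cdot\rangle$ antilinear in the first variable. Let $SV$ be its symmetric algebra with the standard inner product $\langle x_1\cdots x_d\,|\,y_1\cdots y_d\rangle=\sum_{\pi}\prod_k\langle x_k\,|\,y_{\pi(k)}\rangle$ (different degrees being orthogonal), and let $SV'$ be its full antidual, the space of all antilinear functionals $SV\to\mathbb C$. $SV'$ is a commutative algebra under $[\Phi\Psi](\theta)=[\Phi\otimes\Psi](\Delta\theta)$, where $\Delta$ is the algebra homomorphism $SV\to SV\otimes SV$ with $\Delta v=v\otimes1+1\otimes v$ for $v\in V$. Bosonic Fock space $S[V]\subset SV'$ is the Hilbert space of bounded antilinear functionals with the operator norm; $SV$ is included in it by $\psi\mapsto\langle\cdot\,|\,\psi\rangle$. For $v\in V$ the creator $c(v)$ on $SV$ is multiplication by $v$ and the annihilator $a(v)$ is the linear derivation of $SV$ with $a(v)w=\langle v\,|\,w\rangle$ for $w\in V$; on $SV'$ put $[c(v)\Phi](\psi)=\Phi(a(v)\psi)$, $[a(v)\Phi](\psi)=\Phi(c(v)\psi)$ and $\pi(v)=\frac1{\sqrt2}\{c(v)+a(v)\}$.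 In $S[V]$ the operator $\pi(v)$ has the natural domain $\{\Phi\in S[V]:\pi(v)\Phi\in S[V]\}$. Let $g\in\mathrm{Sp}(V)$, that is, $g$ is a real-linear automorphism of $V$ with $\mathrm{Im}\langle gx\,|\,gy\rangle=\mathrm{Im}\langle x\,|\,y\rangle$ for all $x,y\in V$. Write $g=C_g+A_g$ with $C_g$ complex-linear and $A_g$ antilinear; $C_g$ is invertible. Put $Z_g=-A_gC_g^{-1}$, let $\zeta_g\in SV'$ be the functional that vanishes on $S^dV$ for $d\neq2$ and satisfies $\zeta_g(xy)=\langle y\,|\,Z_gx\rangle$ for $x,y\in V$, and let $e^{Z_g}=\sum_{n\ge0}\zeta_g^n/n!\in SV'$. Let $U_g:SV\to SV'$ be the linear map with $U_g1=e^{Z_g}$ and $U_g(v_1\cdots v_n)=c_g(v_1)\cdots c_g(v_n)e^{Z_g}$, where $c_g(v)=c(C_gv)+a(A_gv)$. (i) If $A_g$ is Hilbert–Schmidt, then $e^{Z_g}\in S[V]$, and $\|e^{Z_g}\|^{-1}U_g$ maps $SV$ into $S[V]$ and extends uniquely to a unitary operator $U$ on $S[V]$. This $U$ implements $g$: for every $v\in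 V$ one has $U\pi(v)=\pi(gv)U$ as an equality of operators in $S[V]$ with their natural domains. (ii) Conversely, if for some scalar $c\in\mathbb C$ the map $cU_g$ takes $SV$ into $S[V]$ and extends to a unitary operator on $S[V]$, then $A_g$ is Hilbert–Schmidt. -/

import Mathlib

open scoped TensorProduct ComplexConjugate

noncomputable section

namespace BosonicFock

/-! ### The symmetric algebra, creators and annihilators -/

section Algebra

variable (V : Type*) [NormedAddCommGroup V] [InnerProductSpace ℂ V]

/-- The symmetric algebra `SV`. -/
abbrev Sym := SymmetricAlgebra ℂ V

/-- The full (algebraic) antidual `SV'`: all antilinear functionals `SV → ℂ`. -/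
abbrev AntiDual := Sym V →ₗ⋆[ℂ] ℂ

variable {V}

/-- The inclusion `V → SV`. -/
abbrev inc (v : V) : Sym V := SymmetricAlgebra.ι ℂ V v

theorem sym_induction {P : Sym V → Prop} (one : P 1) (smul : ∀ (c : ℂ) a, P a → P (c • a))
    (add : ∀ a b, P a → P b → P (a + b)) (mul : ∀ v a, P a → P (inc v * a)) (a : Sym V) : P a := by
  suffices h : ∀ a b : Sym V, P b → P (a * b) by simpa using h a 1 one
  intro a
  induction a using SymmetricAlgebra.induction with
  | algebraMap r => intro b hb; rw [← Algebra.smul_def]; exact smul r b hb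
  | ι x => intro b hb; exact mul x b hb
  | mul x y hx hy => intro b hb; rw [mul_assoc]; exact hx _ (hy _ hb)
  | add x y hx hy => intro b hb; rw [add_mul]; exact add _ _ (hx _ hb) (hy _ hb)

/-- A linear map with pairwise commuting values in a (not necessarily commutative) algebra extends
to an algebra homomorphism on the symmetric algebra. -/
def commLift {A : Type*} [Ring A] [Algebra ℂ A] (f : V →ₗ[ℂ] A)
    (hf : ∀ x y, Commute (f x) (f y)) : Sym V →ₐ[ℂ] A :=
  RingCon.liftₐ (TensorAlgebra.symRingCon ℂ V) (TensorAlgebra.lift ℂ f) <| by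
    refine RingCon.ringConGen_le.2 (fun x y h => ?_)
    induction h with | mul_comm x y
    rw [RingCon.ker_apply]
    simpa using (hf x y).eq

@[simp] theorem commLift_inc {A : Type*} [Ring A] [Algebra ℂ A] (f : V →ₗ[ℂ] A)
    (hf : ∀ x y, Commute (f x) (f y)) (v : V) : commLift f hf (inc v) = f v := by
  have h : commLift f hf (inc v) = TensorAlgebra.lift ℂ f (TensorAlgebra.ι ℂ v) := rfl
  simpa using h

/-- The creator `c(v) : SV → SV`, multiplication by `v`. -/
def creator (v : V) : Sym V →ₗ[ℂ] Sym V := LinearMap.mulLeft ℂ (inc v)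

/-- Auxiliary algebra homomorphism `φ ↦ φ + ε a(v)φ`. -/
def annihilatorAux (v : V) : Sym V →ₐ[ℂ] TrivSqZeroExt (Sym V) (Sym V) :=
  SymmetricAlgebra.lift
    ((TrivSqZeroExt.inlAlgHom ℂ (Sym V) (Sym V)).toLinearMap ∘ₗ SymmetricAlgebra.ι ℂ V +
      (TrivSqZeroExt.inrHom (Sym V) (Sym V)).restrictScalars ℂ ∘ₗ
        (LinearMap.toSpanSingleton ℂ (Sym V) 1 ∘ₗ (innerₛₗ ℂ v)))

theorem annihilatorAux_fst (v : V) (φ : Sym V) : (annihilatorAux v φ).fst = φ := by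
  have : (TrivSqZeroExt.fstHom ℂ (Sym V) (Sym V)).comp (annihilatorAux v) = AlgHom.id ℂ _ := by
    apply SymmetricAlgebra.algHom_ext
    ext w
    simp [annihilatorAux]
  exact congr($this φ)

/-- The annihilator `a(v) : SV → SV`: the linear derivation with `a(v) w = ⟨v | w⟩`
for `w ∈ V`. -/
def annihilator (v : V) : Derivation ℂ (Sym V) (Sym V) where
  toLinearMap :=
    (TrivSqZeroExt.sndHom (Sym V) (Sym V)).restrictScalars ℂ ∘ₗ (annihilatorAux v).toLinearMap
  map_one_eq_zero' := by simp
  leibniz' a b := by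
    simp [annihilatorAux_fst, mul_comm]

@[simp] theorem annihilator_inc (v w : V) :
    annihilator v (inc w) = algebraMap ℂ (Sym V) (inner ℂ v w) := by
  change (annihilatorAux v (inc w)).snd = _
  simp [annihilatorAux, Algebra.algebraMap_eq_smul_one]

theorem annihilator_inc_mul (v w : V) (φ : Sym V) :
    annihilator v (inc w * φ) = inner ℂ v w • φ + inc w * annihilator v φ := by
  rw [Derivation.leibniz, annihilator_inc, smul_eq_mul, smul_eq_mul, Algebra.smul_def]
  ring

theorem annihilator_add (v w : V) (φ : Sym V) :
    annihilator (v + w) φ = annihilator v φ + annihilator w φ := by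
  induction φ using sym_induction with
  | one => simp
  | smul c a h => simp [h]
  | add a b ha hb => simp only [map_add, ha, hb]; abel
  | mul x a h => simp only [annihilator_inc_mul, h, inner_add_left, add_smul]; ring

theorem annihilator_smul (c : ℂ) (v : V) (φ : Sym V) :
    annihilator (c • v) φ = conj c • annihilator v φ := by
  induction φ using sym_induction with
  | one => simp
  | smul c a h => simp [h, smul_comm c]
  | add a b ha hb => simp only [map_add, ha, hb, smul_add]
  | mul x a h => simp only [annihilator_inc_mul, h, inner_smul_left, smul_add, mul_smul_comm,
      mul_smul]

theorem annihilator_comm (v w : V) (φ : Sym V) :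
    annihilator v (annihilator w φ) = annihilator w (annihilator v φ) := by
  induction φ using sym_induction with
  | one => simp
  | smul c a h => simp [h]
  | add a b ha hb => simp only [map_add, ha, hb]
  | mul x a h =>
    simp only [annihilator_inc_mul, map_add, Derivation.map_smul, h]
    abel

/-- The creators on the antidual: `[c(v)Φ](ψ) = Φ(a(v)ψ)`. -/
def antiCreator : V →ₗ[ℂ] Module.End ℂ (AntiDual V) where
  toFun v :=
    { toFun := fun Φ => Φ.comp (annihilator v).toLinearMap
      map_add' := fun _ _ => rfl
      map_smul' := fun _ _ => rfl }
  map_add' v w := by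
    ext Φ ψ
    simp [annihilator_add]
  map_smul' c v := by
    ext Φ ψ
    simp [annihilator_smul]

/-- The annihilators on the antidual: `[a(v)Φ](ψ) = Φ(c(v)ψ)`. -/
def antiAnnihilator : V →ₗ⋆[ℂ] Module.End ℂ (AntiDual V) where
  toFun v :=
    { toFun := fun Φ => Φ.comp (creator v)
      map_add' := fun _ _ => rfl
      map_smul' := fun _ _ => rfl }
  map_add' v w := by
    ext Φ ψ
    simp [creator, add_mul]
  map_smul' c v := by
    ext Φ ψ
    simp [creator]

@[simp] theorem antiCreator_apply (v : V) (Φ : AntiDual V) (ψ : Sym V) :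
    antiCreator v Φ ψ = Φ (annihilator v ψ) := rfl

@[simp] theorem antiAnnihilator_apply (v : V) (Φ : AntiDual V) (ψ : Sym V) :
    antiAnnihilator v Φ ψ = Φ (inc v * ψ) := rfl

/-- The field operators `π(v) = (c(v) + a(v)) / √2` on the antidual. -/
def fieldOp (v : V) : Module.End ℂ (AntiDual V) :=
  (((√2 : ℝ) : ℂ)⁻¹) • (antiCreator v + antiAnnihilator v)

/-! ### The inner product on the symmetric algebra -/

/-- The antifunctional `⟨· | 1⟩`: the conjugate of the projection `SV → S⁰V = ℂ`. -/
def vacuum : AntiDual V :=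
  (starLinearEquiv ℂ (A := ℂ)).toLinearMap.comp
    (SymmetricAlgebra.algebraMapInv (R := ℂ) (M := V)).toLinearMap

@[simp] theorem vacuum_apply (ψ : Sym V) :
    vacuum ψ = conj (SymmetricAlgebra.algebraMapInv (R := ℂ) ψ) := rfl

theorem antiCreator_commute (x y : V) : Commute (antiCreator x) (antiCreator y) := by
  ext Φ ψ
  simp [annihilator_comm x y]

/-- The canonical map `SV → SV'`, `ψ ↦ ⟨· | ψ⟩`, determined by `⟨φ | v₁⋯vₙ⟩ =
⟨a(vₙ)⋯a(v₁)φ | 1⟩`. See `pairing_prod` for the formula as a permanent. -/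
def pairing : Sym V →ₗ[ℂ] AntiDual V :=
  (LinearMap.applyₗ (vacuum : AntiDual V)) ∘ₗ (commLift antiCreator antiCreator_commute).toLinearMap

theorem pairing_one : pairing (1 : Sym V) = vacuum := by simp [pairing]

theorem pairing_inc_mul (v : V) (ψ φ : Sym V) :
    pairing (inc v * ψ) φ = pairing ψ (annihilator v φ) := by
  simp [pairing]

theorem annihilator_prod {n : ℕ} (v : V) (x : Fin (n + 1) → V) :
    annihilator v (∏ i, inc (x i)) =
      ∑ k, inner ℂ v (x k) • ∏ i : Fin n, inc (x (Equiv.swap 0 k i.succ)) := by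
  have key : ∀ (s : Finset (Fin (n + 1))), annihilator v (∏ i ∈ s, inc (x i)) =
      ∑ k ∈ s, inner ℂ v (x k) • ∏ i ∈ s.erase k, inc (x i) := by
    intro s
    induction s using Finset.induction_on with
    | empty => simp
    | insert a s ha ih =>
      rw [Finset.prod_insert ha, annihilator_inc_mul, ih, Finset.sum_insert ha,
        Finset.erase_insert ha, Finset.mul_sum]
      congr 1
      refine Finset.sum_congr rfl fun k hk => ?_
      have hak : a ≠ k := fun h => ha (h ▸ hk)
      rw [mul_smul_comm, Finset.erase_insert_of_ne hak, Finset.prod_insert]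
      exact fun h => ha (Finset.mem_of_mem_erase h)
  rw [key]
  refine Finset.sum_congr rfl fun k _ => ?_
  congr 1
  have h1 : ∏ i, (if i = k then 1 else inc (x i)) = ∏ i ∈ Finset.univ.erase k, inc (x i) := by
    rw [← Finset.mul_prod_erase Finset.univ _ (Finset.mem_univ k)]
    rw [if_pos rfl, one_mul]
    exact Finset.prod_congr rfl fun i hi => if_neg (Finset.ne_of_mem_erase hi)
  rw [← h1, ← Equiv.prod_comp (Equiv.swap 0 k), Fin.prod_univ_succ]
  rw [Equiv.swap_apply_left, if_pos rfl, one_mul]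
  refine Finset.prod_congr rfl fun i _ => if_neg ?_
  intro h
  have := (Equiv.swap 0 k).injective (h.trans (Equiv.swap_apply_left 0 k).symm)
  exact Fin.succ_ne_zero i this

/-- `⟨x₁⋯xₙ | y₁⋯yₙ⟩` is the permanent of the matrix `⟨xᵢ | yⱼ⟩`. -/
theorem pairing_prod {n : ℕ} (x y : Fin n → V) :
    pairing (∏ i, inc (y i)) (∏ i, inc (x i)) =
      (Matrix.of fun i j => (inner ℂ (x i) (y j) : ℂ)).permanent := by
  induction n with
  | zero => simp [pairing_one, Matrix.permanent]
  | succ n ih =>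
    rw [Fin.prod_univ_succ, pairing_inc_mul, annihilator_prod, map_sum, Matrix.permanent,
      ← Equiv.sum_comp Equiv.Perm.decomposeFin.symm, Fintype.sum_prod_type]
    refine Finset.sum_congr rfl fun k _ => ?_
    rw [LinearMap.map_smulₛₗ, ih, Matrix.permanent, smul_eq_mul, Finset.mul_sum]
    refine Finset.sum_congr rfl fun e _ => ?_
    rw [Fin.prod_univ_succ]
    simp

theorem pairing_inc_mul_right (v : V) (ψ φ : Sym V) :
    pairing ψ (inc v * φ) = pairing (annihilator v ψ) φ := by
  induction ψ using sym_induction generalizing φ with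
  | one => simp [pairing_one, SymmetricAlgebra.algebraMapInv_ι]
  | smul c a h => simp [h]
  | add a b ha hb => simp [ha, hb]
  | mul w a h =>
    rw [pairing_inc_mul, annihilator_inc_mul, annihilator_inc_mul, map_add, map_add,
      LinearMap.add_apply, pairing_inc_mul, h, LinearMap.map_smulₛₗ, map_smul,
      LinearMap.smul_apply, inner_conj_symm]

theorem pairing_conj (φ ψ : Sym V) : conj (pairing φ ψ) = pairing ψ φ := by
  induction ψ using sym_induction generalizing φ with
  | one =>
    induction φ using sym_induction with
    | one => simp [pairing_one]
    | smul c a h => simp [h]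
    | add a b ha hb => simp [ha, hb]
    | mul v a h => rw [pairing_inc_mul]; simp [pairing_one, SymmetricAlgebra.algebraMapInv_ι]
  | smul c a h => simp [h]
  | add a b ha hb => simp [ha, hb]
  | mul w a h => rw [pairing_inc_mul_right, h, pairing_inc_mul]

/-- `SᵈM` as a subspace of `SV`, for a subspace `M` of `V`. -/
def homog (M : Submodule ℂ V) (d : ℕ) : Submodule ℂ (Sym V) :=
  (M.map (SymmetricAlgebra.ι ℂ V)) ^ d

theorem inc_mul_mem_homog {M : Submodule ℂ V} {d : ℕ} {v : V} (hv : v ∈ M) {φ : Sym V}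
    (hφ : φ ∈ homog M d) : inc v * φ ∈ homog M (d + 1) := by
  rw [homog, pow_succ']
  exact Submodule.mul_mem_mul ⟨v, hv, rfl⟩ hφ

theorem homog_induction {M : Submodule ℂ V} {P : ℕ → Sym V → Prop}
    (smul_one : ∀ c : ℂ, P 0 (c • 1))
    (add : ∀ d a b, P d a → P d b → P d (a + b))
    (mul : ∀ d v a, v ∈ M → a ∈ homog M d → P d a → P (d + 1) (inc v * a))
    {d : ℕ} {a : Sym V} (ha : a ∈ homog M d) : P d a := by
  refine Submodule.pow_induction_on_left' (C := fun d a _ => P d a) _ ?_ ?_ ?_ ha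
  · intro r; rw [Algebra.algebraMap_eq_smul_one]; exact smul_one r
  · intro x y i _ _ hx hy; exact add i x y hx hy
  · rintro _ ⟨v, hv, rfl⟩ i x hx h
    exact mul i v x hv hx h

theorem annihilator_homog_zero {M : Submodule ℂ V} (v : V) {φ : Sym V} (h : φ ∈ homog M 0) :
    annihilator v φ = 0 := by
  rw [homog, pow_zero, Submodule.mem_one] at h
  obtain ⟨c, rfl⟩ := h
  simp

theorem annihilator_mem_homog {M : Submodule ℂ V} (v : V) {d : ℕ} {φ : Sym V}
    (h : φ ∈ homog M d) : annihilator v φ ∈ homog M (d - 1) := by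
  refine homog_induction (P := fun d φ => annihilator v φ ∈ homog M (d - 1)) ?_ ?_ ?_ h
  · intro c; simp
  · intro d a b ha hb; rw [map_add]; exact add_mem ha hb
  · intro d w a hw ha h
    rw [annihilator_inc_mul, Nat.add_sub_cancel]
    refine add_mem (Submodule.smul_mem _ _ ha) ?_
    rcases d with _ | d
    · rw [annihilator_homog_zero v ha, mul_zero]; exact zero_mem _
    · exact inc_mul_mem_homog hw h

theorem number_homog {M : Submodule ℂ V} {ι : Type*} [Fintype ι] (e : OrthonormalBasis ι ℂ M)
    {d : ℕ} {φ : Sym V} (h : φ ∈ homog M d) :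
    ∑ i, inc (e i : V) * annihilator (e i : V) φ = (d : ℂ) • φ := by
  refine homog_induction
    (P := fun d φ => ∑ i, inc (e i : V) * annihilator (e i : V) φ = (d : ℂ) • φ) ?_ ?_ ?_ h
  · intro c; simp
  · intro d a b ha hb; simp only [map_add, mul_add, Finset.sum_add_distrib, ha, hb, smul_add]
  · intro d w a hw ha h
    have hw' : ∑ i, inner ℂ (e i : V) w • inc (e i : V) = inc w := by
      have := congrArg (fun m : M => inc (m : V)) (e.sum_repr' ⟨w, hw⟩)
      simpa [inc] using this
    calc ∑ i, inc (e i : V) * annihilator (e i : V) (inc w * a)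
        = (∑ i, inner ℂ (e i : V) w • inc (e i : V)) * a +
            inc w * ∑ i, inc (e i : V) * annihilator (e i : V) a := by
          rw [Finset.sum_mul, Finset.mul_sum, ← Finset.sum_add_distrib]
          refine Finset.sum_congr rfl fun i _ => ?_
          rw [annihilator_inc_mul, mul_add, mul_smul_comm, smul_mul_assoc]
          ring
      _ = ((d + 1 : ℕ) : ℂ) • (inc w * a) := by
          rw [hw', h, mul_smul_comm, Nat.cast_succ, add_smul, one_smul, add_comm]

theorem pairing_homog_self {M : Submodule ℂ V} [FiniteDimensional ℂ M] {d : ℕ} {φ : Sym V}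
    (h : φ ∈ homog M d) :
    0 ≤ (pairing φ φ).re ∧ ((pairing φ φ).re = 0 → φ = 0) := by
  induction d generalizing φ with
  | zero =>
    rw [homog, pow_zero, Submodule.mem_one] at h
    obtain ⟨c, rfl⟩ := h
    have : pairing (algebraMap ℂ (Sym V) c) (algebraMap ℂ (Sym V) c) = (Complex.normSq c : ℂ) := by
      rw [Algebra.algebraMap_eq_smul_one, LinearMap.map_smulₛₗ, map_smul]
      simp [pairing_one, Complex.mul_conj, mul_comm]
    rw [this, Complex.ofReal_re]
    refine ⟨Complex.normSq_nonneg c, fun h => ?_⟩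
    rw [Complex.normSq_eq_zero.1 h, map_zero]
  | succ d ih =>
    let e := stdOrthonormalBasis ℂ M
    have hN := number_homog e h
    have hm : ∀ i, annihilator (e i : V) φ ∈ homog M d := fun i => annihilator_mem_homog _ h
    have key : ((d + 1 : ℕ) : ℝ) * (pairing φ φ).re =
        ∑ i, (pairing (annihilator (e i : V) φ) (annihilator (e i : V) φ)).re := by
      have := congrArg (fun ψ => (pairing ψ φ).re) hN
      simp only [map_sum, LinearMap.sum_apply, pairing_inc_mul, Complex.re_sum] at this
      rw [this, map_smul, LinearMap.smul_apply, smul_eq_mul, ← Complex.ofReal_natCast,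
        Complex.re_ofReal_mul]
    have hpos : (0 : ℝ) < ((d + 1 : ℕ) : ℝ) := by positivity
    have hs : 0 ≤ ∑ i, (pairing (annihilator (e i : V) φ) (annihilator (e i : V) φ)).re :=
      Finset.sum_nonneg fun i _ => (ih (hm i)).1
    refine ⟨?_, fun h0 => ?_⟩
    · by_contra hneg
      push Not at hneg
      nlinarith
    · rw [h0, mul_zero] at key
      have hz := (Finset.sum_eq_zero_iff_of_nonneg (fun i _ => (ih (hm i)).1)).1 key.symm
      have : ∀ i, annihilator (e i : V) φ = 0 := fun i => (ih (hm i)).2 (hz i (Finset.mem_univ i))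
      simp only [this, mul_zero, Finset.sum_const_zero] at hN
      have hne : ((d + 1 : ℕ) : ℂ) ≠ 0 := by exact_mod_cast Nat.succ_ne_zero d
      exact (smul_eq_zero.1 hN.symm).resolve_left hne

theorem pairing_homog_ne {M : Submodule ℂ V} [FiniteDimensional ℂ M] {d d' : ℕ} (hd : d ≠ d')
    {φ ψ : Sym V} (hφ : φ ∈ homog M d) (hψ : ψ ∈ homog M d') : pairing φ ψ = 0 := by
  let e := stdOrthonormalBasis ℂ M
  have h1 := congrArg (fun χ => pairing χ ψ) (number_homog e hφ)
  have h2 := congrArg (fun χ => pairing φ χ) (number_homog e hψ)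
  simp only [map_sum, LinearMap.sum_apply, pairing_inc_mul, map_smul, LinearMap.smul_apply] at h1
  simp only [map_sum, pairing_inc_mul_right, LinearMap.map_smulₛₗ, Complex.conj_natCast] at h2
  have h3 := h1.symm.trans h2
  rw [smul_eq_mul, smul_eq_mul] at h3
  have : ((d : ℂ) - d') * pairing φ ψ = 0 := by rw [sub_mul, h3, sub_self]
  refine (mul_eq_zero.1 this).resolve_left (sub_ne_zero.2 ?_)
  exact_mod_cast hd

theorem homog_mono {M N : Submodule ℂ V} (h : M ≤ N) (d : ℕ) : homog M d ≤ homog N d :=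
  pow_le_pow_left' (Submodule.map_mono h) d

theorem exists_homog (φ : Sym V) :
    ∃ M : Submodule ℂ V, FiniteDimensional ℂ M ∧ φ ∈ ⨆ d, homog M d := by
  induction φ using sym_induction with
  | one => exact ⟨⊥, inferInstance, Submodule.mem_iSup_of_mem 0 (by simp [homog])⟩
  | smul c a h =>
    obtain ⟨M, hM, h⟩ := h
    exact ⟨M, hM, Submodule.smul_mem _ _ h⟩
  | add a b ha hb =>
    obtain ⟨M, hM, ha⟩ := ha
    obtain ⟨N, hN, hb⟩ := hb
    exact ⟨M ⊔ N, inferInstance, add_mem (iSup_mono (fun d => homog_mono le_sup_left d) ha)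
      (iSup_mono (fun d => homog_mono le_sup_right d) hb)⟩
  | mul v a h =>
    obtain ⟨M, hM, h⟩ := h
    refine ⟨M ⊔ Submodule.span ℂ {v}, inferInstance, ?_⟩
    have h' : a ∈ ⨆ d, homog (M ⊔ Submodule.span ℂ {v}) d :=
      iSup_mono (fun d => homog_mono le_sup_left d) h
    refine Submodule.iSup_induction _
      (motive := fun a => inc v * a ∈ ⨆ d, homog (M ⊔ Submodule.span ℂ {v}) d) h' ?_ ?_ ?_
    · intro d x hx
      exact Submodule.mem_iSup_of_mem (d + 1) (inc_mul_mem_homog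
        (Submodule.mem_sup_right (Submodule.mem_span_singleton_self v)) hx)
    · simp
    · intro x y hx hy; rw [mul_add]; exact add_mem hx hy

theorem pairing_self (φ : Sym V) :
    0 ≤ (pairing φ φ).re ∧ ((pairing φ φ).re = 0 → φ = 0) := by
  obtain ⟨M, hM, h⟩ := exists_homog φ
  obtain ⟨f, hf, rfl⟩ := (Submodule.mem_iSup_iff_exists_finsupp _ _).1 h
  have key : (pairing (f.sum fun _ x => x) (f.sum fun _ x => x)).re =
      ∑ d ∈ f.support, (pairing (f d) (f d)).re := by
    simp only [Finsupp.sum, map_sum, LinearMap.sum_apply, Complex.re_sum]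
    refine Finset.sum_congr rfl fun d hd => ?_
    rw [Finset.sum_eq_single d]
    · intro d' _ hne
      rw [pairing_homog_ne hne (hf d') (hf d), Complex.zero_re]
    · exact fun h => absurd hd h
  rw [key]
  refine ⟨Finset.sum_nonneg fun d _ => (pairing_homog_self (hf d)).1, fun h0 => ?_⟩
  have := (Finset.sum_eq_zero_iff_of_nonneg (fun d _ => (pairing_homog_self (hf d)).1)).1 h0
  exact Finset.sum_eq_zero fun d hd => (pairing_homog_self (hf d)).2 (this d hd)

/-- The standard inner product on `SV`, with `⟨φ | ψ⟩ = pairing ψ φ`. -/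
@[reducible] def symCore : InnerProductSpace.Core ℂ (Sym V) where
  inner φ ψ := pairing ψ φ
  conj_inner_symm φ ψ := pairing_conj φ ψ
  re_inner_nonneg φ := (pairing_self φ).1
  add_left φ ψ χ := map_add _ _ _
  smul_left φ ψ c := by simp
  definite φ h := (pairing_self φ).2 (by
    have h' : pairing φ φ = 0 := h
    rw [h', Complex.zero_re])

instance symNormedAddCommGroup : NormedAddCommGroup (Sym V) := symCore.toNormedAddCommGroup

instance symInnerProductSpace : InnerProductSpace ℂ (Sym V) :=
  InnerProductSpace.ofCore symCore.toCore

theorem sym_inner (φ ψ : Sym V) : inner ℂ φ ψ = pairing ψ φ := rfl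

end Algebra

/-! ### Bosonic Fock space -/

section Fock

theorem norm_antidual_eq {E : Type*} [NormedAddCommGroup E] [InnerProductSpace ℂ E]
    (Φ : E →L⋆[ℂ] ℂ) (h : UniformSpace.Completion E)
    (hΦ : ∀ x : E, Φ x = inner ℂ (x : UniformSpace.Completion E) h) : ‖Φ‖ = ‖h‖ := by
  apply le_antisymm
  · refine Φ.opNorm_le_bound (norm_nonneg h) fun x => ?_
    rw [hΦ, mul_comm, ← UniformSpace.Completion.norm_coe x]
    exact norm_inner_le_norm _ _
  · have key : ∀ y : UniformSpace.Completion E, ‖(inner ℂ y h : ℂ)‖ ≤ ‖Φ‖ * ‖y‖ := by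
      intro y
      induction y using UniformSpace.Completion.induction_on with
      | hp => exact isClosed_le (by fun_prop) (by fun_prop)
      | ih x =>
        rw [← hΦ, UniformSpace.Completion.norm_coe]
        exact Φ.le_opNorm x
    have h1 := key h
    rw [inner_self_eq_norm_sq_to_K] at h1
    by_cases h0 : ‖h‖ = 0
    · rw [h0]; exact norm_nonneg _
    · have h2 : ‖h‖ * ‖h‖ ≤ ‖Φ‖ * ‖h‖ := by
        simpa [sq] using h1
      exact le_of_mul_le_mul_right h2 (lt_of_le_of_ne (norm_nonneg _) (Ne.symm h0))

theorem exists_antidual_vector {E : Type*} [NormedAddCommGroup E] [InnerProductSpace ℂ E]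
    (Φ : E →L⋆[ℂ] ℂ) : ∃ h : UniformSpace.Completion E,
      ∀ x : E, Φ x = inner ℂ (x : UniformSpace.Completion E) h := by
  let f : E →L[ℂ] ℂ := ((starL ℂ (A := ℂ)).toContinuousLinearMap).comp Φ
  let F : UniformSpace.Completion E →L[ℂ] ℂ :=
    f.extend (UniformSpace.Completion.toComplL (𝕜 := ℂ) (E := E))
  have hF : ∀ x : E, F x = f x := fun x =>
    f.extend_eq (UniformSpace.Completion.denseRange_coe)
      (UniformSpace.Completion.isUniformInducing_coe E) x
  refine ⟨(InnerProductSpace.toDual ℂ _).symm F, fun x => ?_⟩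
  rw [← inner_conj_symm, InnerProductSpace.toDual_symm_apply, hF]
  simp [f]

variable (V : Type*) [NormedAddCommGroup V] [InnerProductSpace ℂ V]

/-- Bosonic Fock space `S[V]`: the bounded antilinear functionals on `SV`, with the operator
norm. -/
abbrev Fock := Sym V →L⋆[ℂ] ℂ

variable {V}

theorem fock_parallelogram (Φ Ψ : Fock V) :
    ‖Φ + Ψ‖ * ‖Φ + Ψ‖ + ‖Φ - Ψ‖ * ‖Φ - Ψ‖ = 2 * (‖Φ‖ * ‖Φ‖ + ‖Ψ‖ * ‖Ψ‖) := by
  obtain ⟨h, hh⟩ := exists_antidual_vector Φ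
  obtain ⟨k, hk⟩ := exists_antidual_vector Ψ
  rw [norm_antidual_eq Φ h hh, norm_antidual_eq Ψ k hk,
    norm_antidual_eq (Φ + Ψ) (h + k) (fun x => by simp [hh, hk, inner_add_right]),
    norm_antidual_eq (Φ - Ψ) (h - k) (fun x => by simp [hh, hk, inner_sub_right])]
  simpa only [sq] using parallelogram_law_with_norm ℂ h k

/-- Fock space is a Hilbert space: its norm comes from an inner product (by polarization). -/
instance fockInnerProductSpace : InnerProductSpace ℂ (Fock V) :=
  InnerProductSpace.ofNorm ℂ fock_parallelogram

/-- The inclusion `SV → S[V]`, `ψ ↦ ⟨· | ψ⟩`. -/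
def toFock (ψ : Sym V) : Fock V := innerSLFlip ℂ ψ

theorem toFock_apply (ψ φ : Sym V) : toFock ψ φ = inner ℂ φ ψ := rfl

theorem toFock_coe (ψ : Sym V) : (toFock ψ : AntiDual V) = pairing ψ := rfl

end Fock

/-! ### The product on the antidual and Gaussians -/

section Gaussian

variable {V : Type*} [NormedAddCommGroup V] [InnerProductSpace ℂ V]

/-- The antifunctional `Φ ⊗ Ψ` on `SV ⊗ SV`. -/
def antiTensor (Φ Ψ : AntiDual V) : Sym V ⊗[ℂ] Sym V →ₗ⋆[ℂ] ℂ :=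
  TensorProduct.lift (LinearMap.mk₂'ₛₗ (starRingEnd ℂ) (starRingEnd ℂ) (fun φ ψ => Φ φ * Ψ ψ)
    (fun a b c => by simp [add_mul]) (fun c a b => by simp [mul_assoc])
    (fun a b c => by simp [mul_add]) (fun c a b => by simp; ring))

@[simp] theorem antiTensor_tmul (Φ Ψ : AntiDual V) (φ ψ : Sym V) :
    antiTensor Φ Ψ (φ ⊗ₜ ψ) = Φ φ * Ψ ψ := rfl

/-- The product on the antidual: `[ΦΨ](θ) = [Φ ⊗ Ψ](Δθ)`, where `Δ : SV → SV ⊗ SV` is the algebra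
homomorphism with `Δv = v ⊗ 1 + 1 ⊗ v` for `v ∈ V`. -/
def antiMul (Φ Ψ : AntiDual V) : AntiDual V :=
  (antiTensor Φ Ψ).comp (Coalgebra.comul (R := ℂ) (A := Sym V))

/-- Powers in the antidual, with `Φ⁰ = ⟨· | 1⟩`. -/
def antiPow (Φ : AntiDual V) : ℕ → AntiDual V
  | 0 => vacuum
  | n + 1 => antiMul Φ (antiPow Φ n)

theorem comul_inc_mul (v : V) (θ : Sym V) :
    Coalgebra.comul (R := ℂ) (inc v * θ) =
      (inc v ⊗ₜ[ℂ] 1 + 1 ⊗ₜ[ℂ] inc v) * Coalgebra.comul (R := ℂ) θ := by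
  rw [Bialgebra.comul_mul, SymmetricAlgebra.comul_ι]

theorem antiMul_one_apply (Φ Ψ : AntiDual V) : antiMul Φ Ψ 1 = Φ 1 * Ψ 1 := by
  simp [antiMul, Algebra.TensorProduct.one_def]

theorem antiMul_inc_mul (Φ Ψ : AntiDual V) (v : V) (θ : Sym V) :
    antiMul Φ Ψ (inc v * θ) =
      antiMul (antiAnnihilator v Φ) Ψ θ + antiMul Φ (antiAnnihilator v Ψ) θ := by
  have key : ∀ t : Sym V ⊗[ℂ] Sym V,
      antiTensor Φ Ψ ((inc v ⊗ₜ[ℂ] 1 + 1 ⊗ₜ[ℂ] inc v) * t) =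
        antiTensor (antiAnnihilator v Φ) Ψ t + antiTensor Φ (antiAnnihilator v Ψ) t := by
    intro t
    induction t using TensorProduct.induction_on with
    | zero => simp
    | tmul x y => simp [add_mul]
    | add a b ha hb => rw [mul_add, map_add, ha, hb, map_add, map_add]; ring
  simp only [antiMul, LinearMap.comp_apply, comul_inc_mul, key]

/-- `Φ` vanishes in degrees less than `m`. -/
def VanishesBelow (m : ℕ) (Φ : AntiDual V) : Prop :=
  ∀ l : List V, l.length < m → Φ (l.map inc).prod = 0

theorem VanishesBelow.annihilator {m : ℕ} {Φ : AntiDual V} (h : VanishesBelow m Φ) (v : V) :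
    VanishesBelow (m - 1) (antiAnnihilator v Φ) := by
  intro l hl
  have := h (v :: l) (by simp only [List.length_cons]; omega)
  simpa using this

theorem VanishesBelow.mul {m n : ℕ} {Φ Ψ : AntiDual V} (hΦ : VanishesBelow m Φ)
    (hΨ : VanishesBelow n Ψ) : VanishesBelow (m + n) (antiMul Φ Ψ) := by
  intro l
  induction l generalizing m n Φ Ψ with
  | nil =>
    intro hl
    rw [List.map_nil, List.prod_nil, antiMul_one_apply]
    rcases Nat.eq_zero_or_pos m with rfl | hm
    · have : Ψ 1 = 0 := by simpa using hΨ [] (by simpa using hl)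
      rw [this, mul_zero]
    · have : Φ 1 = 0 := by simpa using hΦ [] (by simpa using hm)
      rw [this, zero_mul]
  | cons v l ih =>
    intro hl
    rw [List.length_cons] at hl
    rw [List.map_cons, List.prod_cons, antiMul_inc_mul,
      ih (hΦ.annihilator v) hΨ (by omega), ih hΦ (hΨ.annihilator v) (by omega), add_zero]

theorem exists_vanishesBelow (ψ : Sym V) :
    ∃ N : ℕ, ∀ Φ : AntiDual V, VanishesBelow N Φ → Φ ψ = 0 := by
  induction ψ using sym_induction with
  | one => exact ⟨1, fun Φ h => by simpa using h [] (by simp)⟩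
  | smul c a h =>
    obtain ⟨N, h⟩ := h
    exact ⟨N, fun Φ hΦ => by simp [h Φ hΦ]⟩
  | add a b ha hb =>
    obtain ⟨M, ha⟩ := ha
    obtain ⟨N, hb⟩ := hb
    exact ⟨max M N, fun Φ h => by
      rw [map_add, ha Φ fun l hl => h l (lt_max_of_lt_left hl),
        hb Φ fun l hl => h l (lt_max_of_lt_right hl), add_zero]⟩
  | mul v a h =>
    obtain ⟨N, h⟩ := h
    exact ⟨N + 1, fun Φ hΦ => h (antiAnnihilator v Φ) (hΦ.annihilator v)⟩

theorem antiPow_vanishesBelow {ζ : AntiDual V} (hζ : ζ 1 = 0) (n : ℕ) :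
    VanishesBelow n (antiPow ζ n) := by
  have h1 : VanishesBelow 1 ζ := by
    intro l hl
    obtain rfl : l = [] := List.eq_nil_of_length_eq_zero (by omega)
    simpa using hζ
  induction n with
  | zero => intro l hl; omega
  | succ n ih =>
    have := h1.mul ih
    rwa [add_comm] at this

theorem antiExp_finite {ζ : AntiDual V} (hζ : ζ 1 = 0) (ψ : Sym V) :
    (Function.support fun n : ℕ => ((n.factorial : ℂ)⁻¹) * antiPow ζ n ψ).Finite := by
  obtain ⟨N, hN⟩ := exists_vanishesBelow ψ
  refine (Set.finite_lt_nat N).subset fun n hn => ?_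
  by_contra hle
  simp only [Set.mem_ofPred_eq, not_lt] at hle
  refine hn ?_
  have : antiPow ζ n ψ = 0 :=
    hN _ fun l hl => antiPow_vanishesBelow hζ n l (lt_of_lt_of_le hl hle)
  simp [this]

/-- The exponential `exp ζ = ∑ₙ ζⁿ / n!` in the antidual, for `ζ` without constant term; on each
element of `SV` only finitely many terms are nonzero. -/
def antiExp (ζ : AntiDual V) (hζ : ζ 1 = 0) : AntiDual V where
  toFun ψ := ∑ᶠ n : ℕ, ((n.factorial : ℂ)⁻¹) * antiPow ζ n ψ
  map_add' φ ψ := by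
    rw [← finsum_add_distrib (antiExp_finite hζ φ) (antiExp_finite hζ ψ)]
    simp only [map_add, mul_add]
  map_smul' c ψ := by
    rw [smul_eq_mul, mul_finsum' _ _ (antiExp_finite hζ ψ)]
    refine finsum_congr fun n => ?_
    rw [LinearMap.map_smulₛₗ, smul_eq_mul]
    ring

section DegreeOne

/-- The projection `SV → S¹V = V`. -/
def degOne : Sym V →ₗ[ℂ] V :=
  letI : Module ℂᵐᵒᵖ V := Module.compHom V ((RingHom.id ℂ).fromOpposite mul_comm)
  haveI : IsCentralScalar ℂ V := ⟨fun _ _ => rfl⟩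
  TrivSqZeroExt.sndHom ℂ V ∘ₗ
    (SymmetricAlgebra.lift (TrivSqZeroExt.inrHom ℂ V) : Sym V →ₐ[ℂ] TrivSqZeroExt ℂ V).toLinearMap

@[simp] theorem degOne_one : degOne (1 : Sym V) = 0 := by
  let _ : Module ℂᵐᵒᵖ V := Module.compHom V ((RingHom.id ℂ).fromOpposite mul_comm)
  have : IsCentralScalar ℂ V := ⟨fun _ _ => rfl⟩
  change ((SymmetricAlgebra.lift (TrivSqZeroExt.inrHom ℂ V) :
      Sym V →ₐ[ℂ] TrivSqZeroExt ℂ V) 1).snd = 0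
  rw [map_one, TrivSqZeroExt.snd_one]

theorem degOne_inc_mul (v : V) (φ : Sym V) :
    degOne (inc v * φ) = SymmetricAlgebra.algebraMapInv (R := ℂ) φ • v := by
  let _ : Module ℂᵐᵒᵖ V := Module.compHom V ((RingHom.id ℂ).fromOpposite mul_comm)
  have : IsCentralScalar ℂ V := ⟨fun _ _ => rfl⟩
  have h : ∀ φ : Sym V, ((SymmetricAlgebra.lift (TrivSqZeroExt.inrHom ℂ V) :
      Sym V →ₐ[ℂ] TrivSqZeroExt ℂ V) φ).fst = SymmetricAlgebra.algebraMapInv (R := ℂ) φ := by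
    intro φ
    have : (TrivSqZeroExt.fstHom ℂ ℂ V).comp (SymmetricAlgebra.lift (TrivSqZeroExt.inrHom ℂ V)) =
        SymmetricAlgebra.algebraMapInv (R := ℂ) (M := V) := by
      apply SymmetricAlgebra.algHom_ext
      ext w
      simp [SymmetricAlgebra.algebraMapInv_ι]
    exact congr($this φ)
  change ((SymmetricAlgebra.lift (TrivSqZeroExt.inrHom ℂ V) :
      Sym V →ₐ[ℂ] TrivSqZeroExt ℂ V) (inc v * φ)).snd = _
  rw [map_mul, TrivSqZeroExt.snd_mul, h, h]
  simp [SymmetricAlgebra.algebraMapInv_ι]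

end DegreeOne

/-- The antifunctional `φ ⊗ ψ ↦ ⟨ψ₁ | Z φ₁⟩` on `SV ⊗ SV`, with subscripts for components of
degree one. -/
def quadTensor (Z : V →ₗ⋆[ℂ] V) : Sym V ⊗[ℂ] Sym V →ₗ⋆[ℂ] ℂ :=
  TensorProduct.lift (LinearMap.mk₂'ₛₗ (starRingEnd ℂ) (starRingEnd ℂ)
    (fun φ ψ => (inner ℂ (degOne ψ) (Z (degOne φ)) : ℂ))
    (fun a b c => by simp) (fun c a b => by simp)
    (fun a b c => by simp) (fun c a b => by simp [mul_comm]))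

/-- The quadratic `ζ ∈ S²V'` corresponding to a symmetric antilinear `Z : V → V`, that is
`ζ(xy) = ⟨y | Zx⟩` with `ζ = 0` on `SᵈV` for `d ≠ 2`; see `quadratic_inc_mul`. -/
def quadratic (Z : V →ₗ⋆[ℂ] V) : AntiDual V :=
  (2⁻¹ : ℂ) • (quadTensor Z).comp (Coalgebra.comul (R := ℂ) (A := Sym V))

theorem quadratic_one (Z : V →ₗ⋆[ℂ] V) : quadratic Z 1 = 0 := by
  simp [quadratic, quadTensor, Algebra.TensorProduct.one_def]

/-- For symmetric `Z` the quadratic satisfies `a(v)ζ = Zv`. -/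
theorem quadratic_inc_mul (Z : V →ₗ⋆[ℂ] V)
    (hZ : ∀ x y, (inner ℂ y (Z x) : ℂ) = inner ℂ x (Z y)) (v : V) (φ : Sym V) :
    quadratic Z (inc v * φ) = inner ℂ (degOne φ) (Z v) := by
  have key : ∀ t : Sym V ⊗[ℂ] Sym V,
      quadTensor Z ((inc v ⊗ₜ[ℂ] 1 + 1 ⊗ₜ[ℂ] inc v) * t) =
        inner ℂ (degOne (TensorProduct.lid ℂ _ (LinearMap.rTensor (Sym V)
          (Coalgebra.counit (R := ℂ)) t))) (Z v) +
        inner ℂ (degOne (TensorProduct.rid ℂ _ (LinearMap.lTensor (Sym V)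
          (Coalgebra.counit (R := ℂ)) t))) (Z v) := by
    intro t
    induction t using TensorProduct.induction_on with
    | zero => simp
    | tmul x y =>
      have hc : ∀ z : Sym V, Coalgebra.counit (R := ℂ) z =
          SymmetricAlgebra.algebraMapInv (R := ℂ) z := fun _ => rfl
      simp only [add_mul, Algebra.TensorProduct.tmul_mul_tmul, one_mul, map_add, quadTensor,
        TensorProduct.lift.tmul, LinearMap.mk₂'ₛₗ_apply, degOne_inc_mul, LinearMap.rTensor_tmul,
        LinearMap.lTensor_tmul, TensorProduct.lid_tmul, TensorProduct.rid_tmul, map_smul, hc,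
        LinearMap.map_smulₛₗ, inner_smul_left, inner_smul_right, hZ (degOne x) v]
    | add a b ha hb =>
      simp only [mul_add, map_add, inner_add_left, ha, hb]
      ring
  simp only [quadratic, LinearMap.smul_apply, LinearMap.comp_apply, comul_inc_mul, key,
    Coalgebra.rTensor_counit_comul, Coalgebra.lTensor_counit_comul, TensorProduct.lid_tmul,
    TensorProduct.rid_tmul, one_smul, smul_eq_mul]
  ring

/-- The Gaussian `e^Z = exp ζ` of a symmetric antilinear `Z : V → V`. -/
def gaussian (Z : V →ₗ⋆[ℂ] V) : AntiDual V := antiExp (quadratic Z) (quadratic_one Z)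

end Gaussian

/-! ### The symplectic group and Fock implementation -/

section Symplectic

variable {V : Type*} [NormedAddCommGroup V] [InnerProductSpace ℂ V]

theorem complex_smul_eq (c : ℂ) (y : V) : c • y = c.re • y + c.im • (Complex.I • y) := by
  conv_lhs => rw [← Complex.re_add_im c]
  rw [add_smul, mul_smul, Complex.coe_smul, Complex.coe_smul]

/-- The complex-linear part `(g - JgJ) / 2` of a real-linear `g`, with `J = i·`. -/
def linPart (g : V →ₗ[ℝ] V) : V →ₗ[ℂ] V where
  toFun x := (2⁻¹ : ℂ) • (g x - Complex.I • g (Complex.I • x))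
  map_add' x y := by simp only [smul_add, map_add]; module
  map_smul' c x := by
    have h := complex_smul_eq (V := V) c
    have h2 : Complex.I • c • x = c.re • (Complex.I • x) - c.im • x := by
      rw [h x, smul_add, smul_comm Complex.I c.re, smul_comm Complex.I c.im, smul_smul Complex.I,
        Complex.I_mul_I]
      module
    rw [h2, h x, map_add, map_sub, g.map_smul, g.map_smul, g.map_smul, g.map_smul,
      RingHom.id_apply, h]
    simp only [smul_sub, smul_add, smul_comm Complex.I c.re, smul_comm Complex.I c.im,
      smul_comm Complex.I (2⁻¹ : ℂ), smul_smul Complex.I Complex.I, Complex.I_mul_I,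
      smul_comm (2⁻¹ : ℂ) c.re, smul_comm (2⁻¹ : ℂ) c.im, neg_smul, one_smul, smul_neg]
    abel

/-- The antilinear part `(g + JgJ) / 2` of a real-linear `g`, with `J = i·`. -/
def antiPart (g : V →ₗ[ℝ] V) : V →ₗ⋆[ℂ] V where
  toFun x := (2⁻¹ : ℂ) • (g x + Complex.I • g (Complex.I • x))
  map_add' x y := by simp only [smul_add, map_add]; module
  map_smul' c x := by
    have h := complex_smul_eq (V := V) c
    have h' : ∀ y : V, conj c • y = c.re • y - c.im • (Complex.I • y) := fun y => by
      rw [complex_smul_eq, Complex.conj_re, Complex.conj_im]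
      module
    have h2 : Complex.I • c • x = c.re • (Complex.I • x) - c.im • x := by
      rw [h x, smul_add, smul_comm Complex.I c.re, smul_comm Complex.I c.im, smul_smul Complex.I,
        Complex.I_mul_I]
      module
    rw [h2, h x, map_add, map_sub, g.map_smul, g.map_smul, g.map_smul, g.map_smul, h']
    simp only [smul_sub, smul_add, smul_comm Complex.I c.re, smul_comm Complex.I c.im,
      smul_comm Complex.I (2⁻¹ : ℂ), smul_smul Complex.I Complex.I, Complex.I_mul_I,
      smul_comm (2⁻¹ : ℂ) c.re, smul_comm (2⁻¹ : ℂ) c.im, neg_smul, one_smul, smul_neg]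
    abel

theorem linPart_add_antiPart (g : V →ₗ[ℝ] V) (x : V) : linPart g x + antiPart g x = g x := by
  change (2⁻¹ : ℂ) • (g x - Complex.I • g (Complex.I • x)) +
    (2⁻¹ : ℂ) • (g x + Complex.I • g (Complex.I • x)) = g x
  module

variable (V) in
/-- `Sp(V)`: the real-linear automorphisms of `V` preserving `Ω = Im ⟨· | ·⟩`. -/
def Symplectic : Subgroup (V ≃ₗ[ℝ] V) where
  carrier := {g | ∀ x y, (inner ℂ (g x) (g y) : ℂ).im = (inner ℂ x y : ℂ).im}
  mul_mem' {a b} ha hb x y := by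
    change (inner ℂ (a (b x)) (a (b y)) : ℂ).im = _
    rw [ha, hb]
  one_mem' x y := rfl
  inv_mem' {a} ha x y := by
    have := ha (a.symm x) (a.symm y)
    rw [LinearEquiv.apply_symm_apply, LinearEquiv.apply_symm_apply] at this
    exact this.symm

/-- `C_g`. -/
def cPart (g : Symplectic V) : V →ₗ[ℂ] V := linPart (g : V ≃ₗ[ℝ] V).toLinearMap

/-- `A_g`. -/
def aPart (g : Symplectic V) : V →ₗ⋆[ℂ] V := antiPart (g : V ≃ₗ[ℝ] V).toLinearMap

theorem cPart_add_aPart (g : Symplectic V) (x : V) :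
    cPart g x + aPart g x = (g : V ≃ₗ[ℝ] V) x := linPart_add_antiPart _ x

theorem inner_parts_im (g : Symplectic V) (x y : V) :
    (inner ℂ (cPart g x) (cPart g y) - inner ℂ (aPart g y) (aPart g x) : ℂ).im =
        (inner ℂ x y : ℂ).im ∧
      (inner ℂ (aPart g x) (cPart g y) - inner ℂ (aPart g y) (cPart g x) : ℂ).im = 0 := by
  have h1 := g.2 x y
  have h2 := g.2 (Complex.I • x) (Complex.I • y)
  have e : ∀ z : ℂ, Complex.I * (Complex.I * z) = -z := fun z => by
    rw [← mul_assoc, Complex.I_mul_I, neg_one_mul]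
  simp only [← cPart_add_aPart, map_smul, LinearMap.map_smulₛₗ, inner_add_left, inner_add_right,
    inner_smul_left, inner_smul_right, Complex.conj_I, map_neg, neg_mul, mul_neg, neg_neg, mul_add, e,
    Complex.add_im, Complex.neg_im] at h1 h2
  rw [← inner_conj_symm (cPart g x) (aPart g y), ← inner_conj_symm (aPart g x) (aPart g y)] at h1 h2
  simp only [Complex.sub_im, Complex.conj_im] at h1 h2 ⊢
  constructor <;> linarith

theorem inner_c_sub_inner_a (g : Symplectic V) (x y : V) :
    (inner ℂ (cPart g x) (cPart g y) - inner ℂ (aPart g y) (aPart g x) : ℂ) = inner ℂ x y := by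
  refine Complex.ext ?_ (inner_parts_im g x y).1
  have h := (inner_parts_im g x (Complex.I • y)).1
  simpa [inner_smul_left, inner_smul_right] using h

theorem inner_a_c_symm (g : Symplectic V) (x y : V) :
    (inner ℂ (aPart g x) (cPart g y) : ℂ) = inner ℂ (aPart g y) (cPart g x) := by
  rw [← sub_eq_zero]
  refine Complex.ext ?_ (inner_parts_im g x y).2
  have h := (inner_parts_im g x (Complex.I • y)).2
  simpa [inner_smul_left, inner_smul_right] using h

theorem inner_cPart_inv (g : Symplectic V) (x y : V) :
    (inner ℂ (cPart g x) y : ℂ) = inner ℂ x (cPart g⁻¹ y) := by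
  have key : ∀ y : V, (inner ℂ (cPart g x) y : ℂ).im = (inner ℂ x (cPart g⁻¹ y) : ℂ).im := by
    intro y
    have h : ∀ u w : V, (inner ℂ ((g : V ≃ₗ[ℝ] V) u) w : ℂ).im =
        (inner ℂ u (((g⁻¹ : Symplectic V) : V ≃ₗ[ℝ] V) w) : ℂ).im := by
      intro u w
      rw [← g.2 u]
      change _ = (inner ℂ _ ((g : V ≃ₗ[ℝ] V) ((g : V ≃ₗ[ℝ] V).symm w)) : ℂ).im
      rw [LinearEquiv.apply_symm_apply]
    have h1 := h x y
    have h2 := h (Complex.I • x) (Complex.I • y)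
    have e : ∀ z : ℂ, Complex.I * (Complex.I * z) = -z := fun z => by
      rw [← mul_assoc, Complex.I_mul_I, neg_one_mul]
    simp only [← cPart_add_aPart, map_smul, LinearMap.map_smulₛₗ, inner_add_left, inner_add_right,
      inner_smul_left, inner_smul_right, Complex.conj_I, map_neg, neg_mul, mul_neg, neg_neg, mul_add, e,
      Complex.add_im, Complex.neg_im] at h1 h2
    linarith
  refine Complex.ext ?_ (key y)
  have h := key (Complex.I • y)
  simpa [inner_smul_left, inner_smul_right] using h

theorem norm_le_norm_cPart (g : Symplectic V) (x : V) : ‖x‖ ≤ ‖cPart g x‖ := by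
  have h := congrArg Complex.re (inner_c_sub_inner_a g x x)
  rw [Complex.sub_re, ← RCLike.re_eq_complex_re, inner_self_eq_norm_sq, inner_self_eq_norm_sq,
    inner_self_eq_norm_sq] at h
  exact le_of_sq_le_sq (by nlinarith [sq_nonneg ‖aPart g x‖]) (norm_nonneg _)

theorem cPart_bijective [CompleteSpace V] (g : Symplectic V) :
    Function.Bijective (cPart g) := by
  have hcont : Continuous (cPart g) := by
    refine LinearMap.continuous_of_seq_closed_graph _ fun u x y hu hy => ?_
    refine ext_inner_right ℂ fun z => ?_
    rw [inner_cPart_inv]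
    refine tendsto_nhds_unique (hy.inner (tendsto_const_nhds (x := z))) ?_
    refine ((hu.inner (tendsto_const_nhds (x := cPart g⁻¹ z)))).congr fun n => ?_
    rw [← inner_cPart_inv]; rfl
  have hanti : AntilipschitzWith 1 (cPart g) :=
    AddMonoidHomClass.antilipschitz_of_bound _ fun x => by
      simpa using norm_le_norm_cPart g x
  have hinj : ∀ h : Symplectic V, Function.Injective (cPart h) := fun h => by
    refine (injective_iff_map_eq_zero _).2 fun x hx => ?_
    have := norm_le_norm_cPart h x
    rw [hx, norm_zero] at this
    exact norm_le_zero_iff.1 this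
  refine ⟨hinj g, ?_⟩
  let C : V →L[ℂ] V := ⟨cPart g, hcont⟩
  have hclosed : IsClosed (Set.range C) :=
    AntilipschitzWith.isClosed_range hanti C.uniformContinuous
  have hcl : IsClosed ((LinearMap.range (cPart g) : Submodule ℂ V) : Set V) := hclosed
  rw [← LinearMap.range_eq_top]
  have : CompleteSpace (LinearMap.range (cPart g)) := hcl.completeSpace_coe
  rw [← Submodule.orthogonal_eq_bot_iff, Submodule.eq_bot_iff]
  intro y hy
  refine hinj g⁻¹ ?_
  rw [map_zero]
  refine ext_inner_left ℂ fun x => ?_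
  rw [← inner_cPart_inv, inner_zero_right]
  exact hy _ ⟨x, rfl⟩

/-- The inverse of `C_g`. -/
def cPartEquiv [CompleteSpace V] (g : Symplectic V) : V ≃ₗ[ℂ] V :=
  LinearEquiv.ofBijective (cPart g) (cPart_bijective g)

/-- `Z_g = -A_g C_g⁻¹`. -/
def zOp [CompleteSpace V] (g : Symplectic V) : V →ₗ⋆[ℂ] V :=
  -((aPart g).comp (cPartEquiv g).symm.toLinearMap)

theorem zOp_symm [CompleteSpace V] (g : Symplectic V) (x y : V) :
    (inner ℂ y (zOp g x) : ℂ) = inner ℂ x (zOp g y) := by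
  obtain ⟨x, rfl⟩ := (cPartEquiv g).surjective x
  obtain ⟨y, rfl⟩ := (cPartEquiv g).surjective y
  have h : ∀ u, zOp g (cPartEquiv g u) = -aPart g u := fun u => by simp [zOp]
  have h' : ∀ u, cPartEquiv g u = cPart g u := fun u => rfl
  rw [h, h, h', h', inner_neg_right, inner_neg_right, ← inner_conj_symm, inner_a_c_symm,
    inner_conj_symm]

/-- The transformed creators `c_g(v) = c(C_g v) + a(A_g v)` on the antidual. -/
def transCreator (g : Symplectic V) : V →ₗ[ℂ] Module.End ℂ (AntiDual V) :=
  antiCreator ∘ₗ cPart g + antiAnnihilator.comp (aPart g)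

theorem transCreator_commute (g : Symplectic V) (x y : V) :
    Commute (transCreator g x) (transCreator g y) := by
  ext Φ ψ
  simp only [transCreator, LinearMap.add_apply, LinearMap.comp_apply, Module.End.mul_apply,
    antiCreator_apply, antiAnnihilator_apply, map_add, annihilator_inc_mul, LinearMap.map_smulₛₗ,
    smul_eq_mul, inner_conj_symm, annihilator_comm (cPart g x), mul_left_comm (inc (aPart g x))]
  rw [inner_a_c_symm g x y]
  ring

/-- `U_g : SV → SV'`, with `U_g 1 = e^{Z_g}` and
`U_g (v₁⋯vₙ) = c_g(v₁)⋯c_g(vₙ) e^{Z_g}`. -/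
def implementer [CompleteSpace V] (g : Symplectic V) : Sym V →ₗ[ℂ] AntiDual V :=
  (LinearMap.applyₗ (gaussian (zOp g))) ∘ₗ
    (commLift (transCreator g) (transCreator_commute g)).toLinearMap

theorem implementer_one [CompleteSpace V] (g : Symplectic V) :
    implementer g 1 = gaussian (zOp g) := by simp [implementer]

theorem implementer_inc_mul [CompleteSpace V] (g : Symplectic V) (v : V) (ψ : Sym V) :
    implementer g (inc v * ψ) = transCreator g v (implementer g ψ) := by simp [implementer]

/-- An antilinear operator on `V` is Hilbert-Schmidt when it is bounded and `∑ ‖T eᵢ‖² < ∞` for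
some (equivalently, every) orthonormal basis of `V`. -/
def IsHilbertSchmidt (T : V →ₗ⋆[ℂ] V) : Prop :=
  Continuous T ∧ ∃ (s : Set V) (e : HilbertBasis s ℂ V), Summable fun i => ‖T (e i)‖ ^ 2

/-- The operator `U` on `S[V]` extends the map `T : SV → SV'`. -/
def Extends (U : Fock V ≃ₗᵢ[ℂ] Fock V) (T : Sym V →ₗ[ℂ] AntiDual V) : Prop :=
  ∀ ψ : Sym V, ((U (toFock ψ) : Fock V) : AntiDual V) = T ψ

/-- The natural domain `{Φ ∈ S[V] : π(v)Φ ∈ S[V]}` of `π(v)` in `S[V]`. -/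
def fieldDomain (v : V) : Set (Fock V) :=
  {Φ | ∃ Ψ : Fock V, (Ψ : AntiDual V) = fieldOp v (Φ : AntiDual V)}

/-- `U π(v) = π(gv) U` for all `v`, as an equality of operators in `S[V]` with their natural
domains. -/
def Implements (U : Fock V ≃ₗᵢ[ℂ] Fock V) (g : Symplectic V) : Prop :=
  ∀ v : V, (∀ Φ : Fock V, Φ ∈ fieldDomain v ↔ U Φ ∈ fieldDomain ((g : V ≃ₗ[ℝ] V) v)) ∧
    ∀ Φ Ψ : Fock V, (Ψ : AntiDual V) = fieldOp v (Φ : AntiDual V) →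
      ((U Ψ : Fock V) : AntiDual V) =
        fieldOp ((g : V ≃ₗ[ℝ] V) v) ((U Φ : Fock V) : AntiDual V)

end Symplectic

end BosonicFock

end

open BosonicFock

/-!
The proof works with exact relations on the algebraic antidual `SV'` and a small amount of analysis
that transfers them to Fock space.

*Algebra.* For symmetric `Z` the Gaussian satisfies `a(v)e^Z = c(Zv)e^Z` (`gaussian_inc_mul`),
and this equation with the value at `1` determines it (`antiDual_ext_of_inc_mul`). Since
`Z_g C_g = -A_g`, the vector `e^{Z_g}` is killed by `a(C_g v) + c(A_g v)`; so `U_g` turns `a(v)`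
into `a(C_g v) + c(A_g v)`, as it turns `c(v)` into `c(C_g v) + a(A_g v)`. Moreover
`(U_{g⁻¹}φ)(ψ)` is the conjugate of `(U_g ψ)(φ)` (`implementer_inv_apply`): both sides satisfy the
relations that determine `U_{g⁻¹}`.

*Boundedness of the Gaussian.* On a finite-dimensional `M ⊆ V` the Gaussian is represented by
`∑ Gₙ` with `Gₙ = qⁿ/n!` for a quadratic `q ∈ S²M`, and `a(v)Gₙ₊₁ = c(PZv)Gₙ` for the orthogonal
projection `P` to `M` and `v ∈ M`. Counting degrees gives, with `t = ‖Z‖` and `h` the squared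
Hilbert-Schmidt norm, `2(n + 1)‖Gₙ₊₁‖² ≤ (h + 2nt²)‖Gₙ‖²` (`norm_sq_gaussPart_succ_le`). For
`t < 1` this bounds `∑ ‖Gₙ‖²` independently of `M`, and `‖Z_g‖ < 1` because
`‖A_g u‖² = ‖C_g u‖² - ‖u‖²` while `C_g` is bounded. Conversely a bounded Gaussian, tested on the
quadratics `q`, bounds the Hilbert-Schmidt norm of `Z_g` (`hsBound_of_norm_gaussian_le`), hence
that of `A_g`.

*Analytic vectors.* Let `Γ(t)` be multiplication by `tᵈ` in degree `d`. For `0 < t < 1` the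
operators `Γ(t)c(v)` and `Γ(t)a(v)` are bounded, so the space of vectors `Γ(t)Φ` with `Φ` in Fock
space and `0 < t < 1` is stable under creators and annihilators, and identities for these vectors
follow from `SV` by density (`IsAnalytic.inner_eq`). As `e^Z = Γ(t)e^{t⁻²Z}`, every `U_g ψ` is
analytic. Thus `U_g` is isometric up to the factor `‖e^{Z_g}‖`; since the extensions for `g` and
`g⁻¹` are adjoint up to a nonzero factor, the extension is surjective. Finally `π(v)` with its
natural domain is the adjoint of `π(v)` on `SV`, and remains in duality with `π(v)` on analytic
vectors; applied to `U⁻¹ψ` for `ψ ∈ SV`, this yields `Uπ(v) = π(gv)U`.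
-/

noncomputable section

namespace BosonicFock

/-! ### Gaussians in the antidual -/

section Algebra

variable {V : Type*} [NormedAddCommGroup V] [InnerProductSpace ℂ V]

theorem antiMul_smul_right (c : ℂ) (Φ Ψ : AntiDual V) (θ : Sym V) :
    antiMul Φ (c • Ψ) θ = c * antiMul Φ Ψ θ := by
  have key : ∀ t : Sym V ⊗[ℂ] Sym V, antiTensor Φ (c • Ψ) t = c * antiTensor Φ Ψ t := by
    intro t
    induction t using TensorProduct.induction_on with
    | zero => simp
    | tmul x y => simp; ring
    | add a b ha hb => rw [map_add, map_add, ha, hb]; ring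
  exact key _

theorem antiMul_add_right (Φ Ψ Ψ' : AntiDual V) (θ : Sym V) :
    antiMul Φ (Ψ + Ψ') θ = antiMul Φ Ψ θ + antiMul Φ Ψ' θ := by
  have key : ∀ t : Sym V ⊗[ℂ] Sym V,
      antiTensor Φ (Ψ + Ψ') t = antiTensor Φ Ψ t + antiTensor Φ Ψ' t := by
    intro t
    induction t using TensorProduct.induction_on with
    | zero => simp
    | tmul x y => simp; ring
    | add a b ha hb => rw [map_add, map_add, map_add, ha, hb]; ring
  exact key _

theorem antiMul_zero_right (Φ : AntiDual V) (θ : Sym V) : antiMul Φ 0 θ = 0 := by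
  simpa using antiMul_smul_right 0 Φ 0 θ

theorem antiMul_comm (Φ Ψ : AntiDual V) : antiMul Φ Ψ = antiMul Ψ Φ := by
  ext θ
  induction θ using sym_induction generalizing Φ Ψ with
  | one => rw [antiMul_one_apply, antiMul_one_apply, mul_comm]
  | smul c a h => rw [LinearMap.map_smulₛₗ, LinearMap.map_smulₛₗ, h]
  | add a b ha hb => rw [map_add, map_add, ha, hb]
  | mul v a h => rw [antiMul_inc_mul, antiMul_inc_mul, h, h Φ, add_comm]

theorem antiAnnihilator_vacuum (v : V) : antiAnnihilator v (vacuum : AntiDual V) = 0 := by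
  ext θ
  simp [SymmetricAlgebra.algebraMapInv_ι]

theorem vacuum_one : (vacuum : AntiDual V) 1 = 1 := by simp

theorem antiMul_vacuum (Φ : AntiDual V) : antiMul Φ vacuum = Φ := by
  ext θ
  induction θ using sym_induction generalizing Φ with
  | one => rw [antiMul_one_apply, vacuum_one, mul_one]
  | smul c a h => rw [LinearMap.map_smulₛₗ, LinearMap.map_smulₛₗ, h]
  | add a b ha hb => rw [map_add, map_add, ha, hb]
  | mul v a h =>
    rw [antiMul_inc_mul, antiAnnihilator_vacuum, antiMul_zero_right, add_zero, h]
    rfl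

theorem antiAnnihilator_antiCreator (v w : V) (Φ : AntiDual V) :
    antiAnnihilator v (antiCreator w Φ) =
      antiCreator w (antiAnnihilator v Φ) + (inner ℂ v w : ℂ) • Φ := by
  ext θ
  rw [antiAnnihilator_apply, antiCreator_apply, annihilator_inc_mul, map_add,
    LinearMap.map_smulₛₗ, inner_conj_symm, add_comm]
  rfl

/-- The creator `c(w)` on the antidual is a multiplication operator. -/
theorem antiMul_antiCreator (w : V) (Φ Ψ : AntiDual V) :
    antiMul Φ (antiCreator w Ψ) = antiCreator w (antiMul Φ Ψ) := by
  ext θ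
  induction θ using sym_induction generalizing Φ Ψ with
  | one => simp [antiMul_one_apply]
  | smul c a h => rw [LinearMap.map_smulₛₗ, LinearMap.map_smulₛₗ, h]
  | add a b ha hb => rw [map_add, map_add, ha, hb]
  | mul v a h =>
    rw [antiMul_inc_mul, h, antiAnnihilator_antiCreator, antiMul_add_right, h,
      antiMul_smul_right, antiCreator_apply, antiCreator_apply, antiCreator_apply,
      annihilator_inc_mul, map_add, antiMul_inc_mul, LinearMap.map_smulₛₗ, inner_conj_symm,
      smul_eq_mul]
    ring

theorem inner_degOne (w : V) (φ : Sym V) :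
    (inner ℂ (degOne φ) w : ℂ) = vacuum (annihilator w φ) := by
  induction φ using sym_induction with
  | one => simp
  | smul c a h =>
    rw [map_smul, inner_smul_left, h, Derivation.map_smul, LinearMap.map_smulₛₗ, smul_eq_mul]
  | add a b ha hb => simp only [map_add, inner_add_left, ha, hb]
  | mul v a h =>
    rw [degOne_inc_mul, annihilator_inc_mul, map_add, inner_smul_left, LinearMap.map_smulₛₗ,
      inner_conj_symm]
    simp [SymmetricAlgebra.algebraMapInv_ι, mul_comm]

theorem antiAnnihilator_quadratic (Z : V →ₗ⋆[ℂ] V)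
    (hZ : ∀ x y, (inner ℂ y (Z x) : ℂ) = inner ℂ x (Z y)) (v : V) :
    antiAnnihilator v (quadratic Z) = antiCreator (Z v) vacuum := by
  ext φ
  rw [antiAnnihilator_apply, quadratic_inc_mul Z hZ, inner_degOne, antiCreator_apply]

theorem antiAnnihilator_antiPow_quadratic (Z : V →ₗ⋆[ℂ] V)
    (hZ : ∀ x y, (inner ℂ y (Z x) : ℂ) = inner ℂ x (Z y)) (v : V) (n : ℕ) :
    antiAnnihilator v (antiPow (quadratic Z) (n + 1)) =
      ((n + 1 : ℕ) : ℂ) • antiCreator (Z v) (antiPow (quadratic Z) n) := by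
  induction n with
  | zero =>
    ext θ
    rw [antiAnnihilator_apply]
    simp only [antiPow, antiMul_vacuum]
    rw [← antiAnnihilator_apply, antiAnnihilator_quadratic Z hZ]
    simp
  | succ n ih =>
    ext θ
    rw [antiAnnihilator_apply, antiPow, antiMul_inc_mul, ih, antiMul_smul_right,
      antiMul_antiCreator, antiAnnihilator_quadratic Z hZ, antiMul_comm, antiMul_antiCreator,
      antiMul_vacuum, ← antiPow, LinearMap.smul_apply, smul_eq_mul]
    push_cast
    ring

theorem gaussian_eq_tsum (Z : V →ₗ⋆[ℂ] V) (ψ : Sym V) :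
    gaussian Z ψ = ∑' n : ℕ, ((n.factorial : ℂ)⁻¹) * antiPow (quadratic Z) n ψ :=
  (tsum_eq_finsum (antiExp_finite (quadratic_one Z) ψ)).symm

theorem gaussian_one (Z : V →ₗ⋆[ℂ] V) : gaussian Z 1 = 1 := by
  rw [gaussian_eq_tsum, tsum_eq_single 0]
  · simp [antiPow]
  · intro n hn
    obtain ⟨m, rfl⟩ := Nat.exists_eq_succ_of_ne_zero hn
    simp [antiPow, antiMul_one_apply, quadratic_one]

/-- The Gaussian solves `a(v) e^Z = c(Zv) e^Z`. -/
theorem gaussian_inc_mul (Z : V →ₗ⋆[ℂ] V)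
    (hZ : ∀ x y, (inner ℂ y (Z x) : ℂ) = inner ℂ x (Z y)) (v : V) (θ : Sym V) :
    gaussian Z (inc v * θ) = gaussian Z (annihilator (Z v) θ) := by
  rw [gaussian_eq_tsum, gaussian_eq_tsum,
    (summable_of_hasFiniteSupport (antiExp_finite (quadratic_one Z) (inc v * θ))).tsum_eq_zero_add]
  have h0 : antiPow (quadratic Z) 0 (inc v * θ) = 0 := by
    simp [antiPow, SymmetricAlgebra.algebraMapInv_ι]
  rw [h0, mul_zero, zero_add]
  refine tsum_congr fun n => ?_
  rw [← antiAnnihilator_apply, antiAnnihilator_antiPow_quadratic Z hZ, LinearMap.smul_apply,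
    antiCreator_apply, Nat.factorial_succ, smul_eq_mul, ← mul_assoc]
  congr 1
  have h1 : ((n + 1 : ℕ) : ℂ) ≠ 0 := by exact_mod_cast Nat.succ_ne_zero n
  have h2 : (n.factorial : ℂ) ≠ 0 := by exact_mod_cast n.factorial_ne_zero
  push_cast at h1 ⊢
  field_simp

/-- An antifunctional with `a(v)Φ = c(Zv)Φ` for all `v` is determined by its value at `1`, because
the equation expresses its degree `d + 1` part through its degree `d - 1` part. -/
theorem antiDual_ext_of_inc_mul {Z : V → V} {Φ Ψ : AntiDual V} (h1 : Φ 1 = Ψ 1)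
    (hΦ : ∀ v θ, Φ (inc v * θ) = Φ (annihilator (Z v) θ))
    (hΨ : ∀ v θ, Ψ (inc v * θ) = Ψ (annihilator (Z v) θ)) : Φ = Ψ := by
  ext ψ
  obtain ⟨M, -, hψ⟩ := exists_homog ψ
  have key : ∀ d, ∀ a ∈ homog M d, Φ a = Ψ a := by
    intro d
    induction d using Nat.strong_induction_on with
    | _ d ih =>
      intro a ha
      refine homog_induction
        (P := fun d a => (∀ m < d, ∀ a ∈ homog M m, Φ a = Ψ a) → Φ a = Ψ a) ?_ ?_ ?_ ha ih
      · intro c _; rw [LinearMap.map_smulₛₗ, LinearMap.map_smulₛₗ, h1]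
      · intro d a b ha hb h; rw [map_add, map_add, ha h, hb h]
      · intro d v a _ ha _ h
        rw [hΦ, hΨ]
        exact h (d - 1) (by omega) _ (annihilator_mem_homog _ ha)
  refine Submodule.iSup_induction _ (motive := fun a => Φ a = Ψ a) hψ key (by simp) ?_
  intro a b ha hb
  rw [map_add, map_add, ha, hb]

end Algebra

/-! ### Algebra of the maps `U_g` -/

section Symplectic

variable {V : Type*} [NormedAddCommGroup V] [InnerProductSpace ℂ V]

/-- The complex-linear and antilinear parts of `g g⁻¹ = 1`. -/
theorem parts_comp_inv (g : Symplectic V) (u : V) :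
    cPart g (cPart g⁻¹ u) + aPart g (aPart g⁻¹ u) = u ∧
      cPart g (aPart g⁻¹ u) + aPart g (cPart g⁻¹ u) = 0 := by
  have h : ∀ u : V, cPart g (cPart g⁻¹ u) + cPart g (aPart g⁻¹ u) + (aPart g (cPart g⁻¹ u) +
      aPart g (aPart g⁻¹ u)) = u := by
    intro u
    rw [← map_add, ← map_add, cPart_add_aPart, cPart_add_aPart]
    exact (g : V ≃ₗ[ℝ] V).apply_symm_apply u
  have h1 := h u
  have h2 := congrArg (fun x => (-Complex.I) • x) (h (Complex.I • u))
  simp only [map_smul, LinearMap.map_smulₛₗ, Complex.conj_I, smul_add, smul_smul, map_neg,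
    smul_neg, neg_mul, neg_neg, Complex.I_mul_I, one_smul, neg_smul] at h2
  constructor
  · linear_combination (norm := module) (2⁻¹ : ℂ) • h1 + (2⁻¹ : ℂ) • h2
  · linear_combination (norm := module) (2⁻¹ : ℂ) • h1 - (2⁻¹ : ℂ) • h2

variable [CompleteSpace V]

theorem zOp_cPart (g : Symplectic V) (u : V) : zOp g (cPart g u) = -aPart g u := by
  have : zOp g (cPartEquiv g u) = -aPart g u := by simp [zOp]
  exact this

theorem implementer_inc_mul_apply (g : Symplectic V) (v : V) (ψ θ : Sym V) :
    implementer g (inc v * ψ) θ =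
      implementer g ψ (annihilator (cPart g v) θ) + implementer g ψ (inc (aPart g v) * θ) := by
  rw [implementer_inc_mul]
  rfl

/-- `U_g` carries the annihilator `a(v)` to `a(C_g v) + c(A_g v)`. -/
theorem implementer_annihilator_apply (g : Symplectic V) (v : V) (ψ θ : Sym V) :
    implementer g (annihilator v ψ) θ =
      implementer g ψ (inc (cPart g v) * θ) + implementer g ψ (annihilator (aPart g v) θ) := by
  induction ψ using sym_induction generalizing θ with
  | one =>
    rw [implementer_one, gaussian_inc_mul _ (zOp_symm g), zOp_cPart]
    have : annihilator (-aPart g v) θ = -annihilator (aPart g v) θ := by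
      simpa using annihilator_smul (-1) (aPart g v) θ
    simp [this]
  | smul c a h => simp only [Derivation.map_smul, map_smul, LinearMap.smul_apply, h, smul_add]
  | add a b ha hb => simp only [map_add, LinearMap.add_apply, ha, hb]; ring
  | mul w a h =>
    simp only [annihilator_inc_mul, map_add, map_smul, LinearMap.add_apply, LinearMap.smul_apply,
      implementer_inc_mul_apply, h, LinearMap.map_smulₛₗ, inner_conj_symm, smul_eq_mul,
      annihilator_comm (aPart g v), mul_left_comm (inc (aPart g w))]
    rw [← inner_c_sub_inner_a g v w]
    ring

/-- Combining the transforms of `c(v)` and `a(v)` recovers `c(u)` on the antidual. -/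
theorem implementer_inc_mul_inv (g : Symplectic V) (u : V) (ψ θ : Sym V) :
    implementer g (inc (cPart g⁻¹ u) * ψ) θ + implementer g (annihilator (aPart g⁻¹ u) ψ) θ =
      implementer g ψ (annihilator u θ) := by
  rw [implementer_inc_mul_apply, implementer_annihilator_apply]
  have h1 := congrArg (fun x => implementer g ψ (annihilator x θ)) (parts_comp_inv g u).1
  have h2 := congrArg (fun x => implementer g ψ (inc x * θ)) (parts_comp_inv g u).2
  simp only [annihilator_add, map_add, add_mul, map_zero, zero_mul] at h1 h2
  linear_combination h1 + h2

/-- Combining the transforms of `c(v)` and `a(v)` recovers `a(u)` on the antidual. -/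
theorem implementer_annihilator_inv (g : Symplectic V) (u : V) (ψ θ : Sym V) :
    implementer g (annihilator (cPart g⁻¹ u) ψ) θ + implementer g (inc (aPart g⁻¹ u) * ψ) θ =
      implementer g ψ (inc u * θ) := by
  rw [implementer_inc_mul_apply, implementer_annihilator_apply]
  have h1 := congrArg (fun x => implementer g ψ (inc x * θ)) (parts_comp_inv g u).1
  have h2 := congrArg (fun x => implementer g ψ (annihilator x θ)) (parts_comp_inv g u).2
  have h3 : annihilator (0 : V) θ = 0 := by simpa using annihilator_smul 0 (0 : V) θ
  simp only [annihilator_add, map_add, add_mul, h3, map_zero] at h1 h2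
  linear_combination h1 + h2

/-- `U_{g⁻¹}` is the formal adjoint of `U_g`: after conjugation and exchange of arguments, `U_g`
satisfies the relations that determine `U_{g⁻¹}`. -/
theorem implementer_inv_apply (g : Symplectic V) (φ ψ : Sym V) :
    implementer g⁻¹ φ ψ = conj (implementer g ψ φ) := by
  induction φ using sym_induction generalizing ψ with
  | one =>
    let Φ : AntiDual V :=
      { toFun := fun ψ => conj (implementer g ψ 1)
        map_add' := fun a b => by simp
        map_smul' := fun c a => by simp }
    have hΦ : ∀ ψ, Φ ψ = conj (implementer g ψ 1) := fun _ => rfl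
    rw [implementer_one, ← hΦ]
    congr 1
    refine antiDual_ext_of_inc_mul (Z := zOp g⁻¹) ?_ (gaussian_inc_mul _ (zOp_symm _)) ?_
    · rw [gaussian_one, hΦ, implementer_one, gaussian_one, map_one]
    · intro v θ
      obtain ⟨u, rfl⟩ := (cPart_bijective g⁻¹).surjective v
      have h := implementer_inc_mul_inv g u θ 1
      rw [zOp_cPart]
      have hn : annihilator (-aPart g⁻¹ u) θ = -annihilator (aPart g⁻¹ u) θ := by
        simpa using annihilator_smul (-1) (aPart g⁻¹ u) θ
      rw [hn, map_neg, hΦ, hΦ, ← map_neg, eq_neg_of_add_eq_zero_left (h.trans ?_)]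
      simp
  | smul c a h => simp only [map_smul, LinearMap.smul_apply, h, LinearMap.map_smulₛₗ]; simp
  | add a b ha hb => simp only [map_add, LinearMap.add_apply, ha, hb]
  | mul w a h =>
    rw [implementer_inc_mul_apply, h, h, ← map_add, ← implementer_annihilator_inv]

end Symplectic

/-! ### The inner product of Fock space -/

section FockSpace

variable {V : Type*} [NormedAddCommGroup V] [InnerProductSpace ℂ V]

/-- A shortcut to the inner product of Fock space, which instance search would otherwise reach
through the module structure over the C⋆-algebra `ℂ`. -/
instance fockInner : Inner ℂ (Fock V) := fockInnerProductSpace.toInner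

theorem fock_inner_smul_left (c : ℂ) (Φ Ψ : Fock V) :
    (inner ℂ (c • Φ) Ψ : ℂ) = conj c * inner ℂ Φ Ψ :=
  inner_smul_left (𝕜 := ℂ) (E := Fock V) Φ Ψ c

theorem fock_inner_smul_right (c : ℂ) (Φ Ψ : Fock V) :
    (inner ℂ Φ (c • Ψ) : ℂ) = c * inner ℂ Φ Ψ :=
  inner_smul_right (𝕜 := ℂ) (E := Fock V) Φ Ψ c

/-- The inner product of `S[V]`, defined by polarization, is compatible with evaluation. -/
theorem inner_toFock (ψ : Sym V) (Φ : Fock V) : inner ℂ (toFock ψ) Φ = Φ ψ := by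
  obtain ⟨h, hh⟩ := exists_antidual_vector Φ
  have hadd : ∀ c : ℂ, ‖toFock ψ + c • Φ‖ = ‖(ψ : UniformSpace.Completion (Sym V)) + c • h‖ :=
    fun c => norm_antidual_eq _ _ fun x => by
      rw [inner_add_right, inner_smul_right, ← hh, UniformSpace.Completion.inner_coe]
      rfl
  have hsub : ∀ c : ℂ, ‖toFock ψ - c • Φ‖ = ‖(ψ : UniformSpace.Completion (Sym V)) - c • h‖ :=
    fun c => norm_antidual_eq _ _ fun x => by
      rw [inner_sub_right, inner_smul_right, ← hh, UniformSpace.Completion.inner_coe]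
      rfl
  have h1 := hadd 1
  have h2 := hsub 1
  simp only [one_smul] at h1 h2
  rw [hh, inner_eq_sum_norm_sq_div_four (𝕜 := ℂ),
    inner_eq_sum_norm_sq_div_four (𝕜 := ℂ) (ψ : UniformSpace.Completion (Sym V))]
  simp only [hadd, hsub, h1, h2]

theorem inner_toFock_right (ψ : Sym V) (Φ : Fock V) : inner ℂ Φ (toFock ψ) = conj (Φ ψ) := by
  rw [← inner_conj_symm, inner_toFock]

theorem norm_toFock (ψ : Sym V) : ‖toFock ψ‖ = ‖ψ‖ := by
  have h := inner_toFock ψ (toFock ψ)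
  rw [toFock_apply, inner_self_eq_norm_sq_to_K, inner_self_eq_norm_sq_to_K] at h
  have h' : ‖toFock ψ‖ ^ 2 = ‖ψ‖ ^ 2 := by exact_mod_cast h
  exact (sq_eq_sq₀ (norm_nonneg _) (norm_nonneg _)).1 h'

theorem isometry_toFock : Isometry (toFock : Sym V → Fock V) :=
  AddMonoidHomClass.isometry_of_norm (innerSLFlip ℂ) norm_toFock

theorem denseRange_toFock : DenseRange (toFock : Sym V → Fock V) := by
  have h : (LinearMap.range (innerSLFlip ℂ (E := Sym V)).toLinearMap).topologicalClosure = ⊤ := by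
    rw [Submodule.topologicalClosure_eq_top_iff, Submodule.eq_bot_iff]
    intro Φ hΦ
    ext ψ
    rw [← inner_toFock]
    exact hΦ _ ⟨ψ, rfl⟩
  exact Submodule.dense_iff_topologicalClosure_eq_top.2 h

theorem sym_norm_sq (φ : Sym V) : ((‖φ‖ ^ 2 : ℝ) : ℂ) = pairing φ φ := by
  rw [← sym_inner, inner_self_eq_norm_sq_to_K]
  norm_cast

theorem inner_annihilator (v : V) (φ ψ : Sym V) :
    (inner ℂ (annihilator v φ) ψ : ℂ) = inner ℂ φ (inc v * ψ) := by
  rw [sym_inner, sym_inner, pairing_inc_mul]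

theorem inner_inc_mul (v : V) (φ ψ : Sym V) :
    (inner ℂ (inc v * φ) ψ : ℂ) = inner ℂ φ (annihilator v ψ) := by
  rw [sym_inner, sym_inner, pairing_inc_mul_right]

theorem norm_sq_inc_mul (v : V) (φ : Sym V) :
    ‖inc v * φ‖ ^ 2 = ‖v‖ ^ 2 * ‖φ‖ ^ 2 + ‖annihilator v φ‖ ^ 2 := by
  have h : (inner ℂ (inc v * φ) (inc v * φ) : ℂ) =
      inner ℂ v v * inner ℂ φ φ + inner ℂ (annihilator v φ) (annihilator v φ) := by
    rw [inner_inc_mul, annihilator_inc_mul, inner_add_right, inner_smul_right,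
      inner_annihilator]
  simp only [inner_self_eq_norm_sq_to_K] at h
  exact_mod_cast h

end FockSpace

/-! ### Annihilators in a fixed degree -/

section Homog

variable {V : Type*} [NormedAddCommGroup V] [InnerProductSpace ℂ V]
  {M : Submodule ℂ V} {ι : Type*} [Fintype ι]

theorem orthonormal_coe (e : OrthonormalBasis ι ℂ M) : Orthonormal ℂ fun i => (e i : V) :=
  e.orthonormal.comp_linearIsometry M.subtypeₗᵢ

theorem sum_inner_smul_coe (e : OrthonormalBasis ι ℂ M) {w : V} (hw : w ∈ M) :
    ∑ i, (inner ℂ (e i : V) w : ℂ) • (e i : V) = w := by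
  have := congrArg (fun m : M => (m : V)) (e.sum_repr' ⟨w, hw⟩)
  simpa using this

/-- On `SM` the annihilator `a(v)` depends only on the orthogonal projection of `v` to `M`. -/
theorem annihilator_eq_sum (e : OrthonormalBasis ι ℂ M) (v : V) {d : ℕ} {φ : Sym V}
    (h : φ ∈ homog M d) :
    annihilator v φ = ∑ i, (inner ℂ v (e i : V) : ℂ) • annihilator (e i : V) φ := by
  refine homog_induction (P := fun _ φ =>
    annihilator v φ = ∑ i, (inner ℂ v (e i : V) : ℂ) • annihilator (e i : V) φ) ?_ ?_ ?_ h
  · intro c; simp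
  · intro d a b ha hb; simp only [map_add, smul_add, Finset.sum_add_distrib, ← ha, ← hb]
  · intro d w a hw _ ha
    simp only [annihilator_inc_mul, smul_add, Finset.sum_add_distrib, ← mul_smul_comm,
      ← Finset.mul_sum, ← ha, smul_smul, ← Finset.sum_smul]
    congr 2
    conv_lhs => rw [← sum_inner_smul_coe e hw]
    simp [mul_comm]

/-- The norm form of `∑ᵢ c(eᵢ)a(eᵢ) = d` on `SᵈM`. -/
theorem sum_norm_sq_annihilator (e : OrthonormalBasis ι ℂ M) {d : ℕ} {φ : Sym V}
    (h : φ ∈ homog M d) : ∑ i, ‖annihilator (e i : V) φ‖ ^ 2 = d * ‖φ‖ ^ 2 := by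
  have h1 : (∑ i, (inner ℂ (annihilator (e i : V) φ) (annihilator (e i : V) φ) : ℂ)) =
      ((d : ℝ) : ℂ) * inner ℂ φ φ := by
    simp only [Complex.ofReal_natCast, inner_annihilator, ← inner_sum, number_homog e h,
      inner_smul_right]
  simp only [inner_self_eq_norm_sq_to_K] at h1
  apply Complex.ofReal_injective
  push_cast at h1 ⊢
  exact h1

theorem norm_annihilator_homog_le [FiniteDimensional ℂ M] (v : V) {d : ℕ} {φ : Sym V}
    (h : φ ∈ homog M d) : ‖annihilator v φ‖ ^ 2 ≤ ‖v‖ ^ 2 * (d * ‖φ‖ ^ 2) := by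
  let e := stdOrthonormalBasis ℂ M
  rw [annihilator_eq_sum e v h, ← sum_norm_sq_annihilator e h]
  calc ‖∑ i, (inner ℂ v (e i : V) : ℂ) • annihilator (e i : V) φ‖ ^ 2
      ≤ (∑ i, ‖(inner ℂ v (e i : V) : ℂ)‖ * ‖annihilator (e i : V) φ‖) ^ 2 := by
        gcongr
        exact (norm_sum_le _ _).trans_eq (Finset.sum_congr rfl fun i _ => norm_smul _ _)
    _ ≤ (∑ i, ‖(inner ℂ v (e i : V) : ℂ)‖ ^ 2) * ∑ i, ‖annihilator (e i : V) φ‖ ^ 2 :=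
        Finset.sum_mul_sq_le_sq_mul_sq _ _ _
    _ ≤ ‖v‖ ^ 2 * ∑ i, ‖annihilator (e i : V) φ‖ ^ 2 := by
        gcongr
        have := (orthonormal_coe e).sum_inner_products_le v (s := Finset.univ)
        simpa only [norm_inner_symm] using this

theorem norm_sq_sum_of_orthogonal {E κ : Type*} [NormedAddCommGroup E] [InnerProductSpace ℂ E]
    (s : Finset κ) (f : κ → E) (hf : ∀ i j, i ≠ j → (inner ℂ (f i) (f j) : ℂ) = 0) :
    ‖∑ i ∈ s, f i‖ ^ 2 = ∑ i ∈ s, ‖f i‖ ^ 2 := by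
  have h : (inner ℂ (∑ i ∈ s, f i) (∑ i ∈ s, f i) : ℂ) = ∑ i ∈ s, inner ℂ (f i) (f i) := by
    rw [sum_inner]
    refine Finset.sum_congr rfl fun i hi => ?_
    rw [inner_sum, Finset.sum_eq_single i (fun j _ hj => hf i j hj.symm) fun h => absurd hi h]
  simp only [inner_self_eq_norm_sq_to_K] at h
  exact_mod_cast h

/-- An operator on `SV` that respects orthogonality of degrees is bounded by `C` if it is bounded by
`C` in each degree. -/
theorem norm_map_le_of_homog (T : Sym V →ₗ[ℂ] Sym V) {C : ℝ} (hC : 0 ≤ C)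
    (hT : ∀ (M : Submodule ℂ V) [FiniteDimensional ℂ M] (d : ℕ), ∀ φ ∈ homog M d,
      ‖T φ‖ ^ 2 ≤ C ^ 2 * ‖φ‖ ^ 2)
    (ho : ∀ (M : Submodule ℂ V) [FiniteDimensional ℂ M] (d d' : ℕ), d ≠ d' → ∀ φ ∈ homog M d,
      ∀ ψ ∈ homog M d', (inner ℂ (T φ) (T ψ) : ℂ) = 0) (φ : Sym V) :
    ‖T φ‖ ≤ C * ‖φ‖ := by
  obtain ⟨M, hM, h⟩ := exists_homog φ
  obtain ⟨f, hf, rfl⟩ := (Submodule.mem_iSup_iff_exists_finsupp _ _).1 h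
  refine le_of_sq_le_sq ?_ (by positivity)
  rw [Finsupp.sum, map_sum, mul_pow, norm_sq_sum_of_orthogonal, norm_sq_sum_of_orthogonal,
    Finset.mul_sum]
  · exact Finset.sum_le_sum fun d _ => hT M d _ (hf d)
  · intro d d' hd
    rw [sym_inner]
    exact pairing_homog_ne hd.symm (hf d') (hf d)
  · intro d d' hd
    exact ho M d d' hd _ (hf d) _ (hf d')

end Homog

/-! ### Dilations -/

section Dilation

variable {V : Type*} [NormedAddCommGroup V] [InnerProductSpace ℂ V]

/-- The dilation `Γ(t)` of `SV`: the algebra endomorphism with `v ↦ tv` for `v ∈ V`; it is the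
scalar `tᵈ` in degree `d`. -/
def dilation (t : ℝ) : Sym V →ₐ[ℂ] Sym V :=
  SymmetricAlgebra.lift ((t : ℂ) • SymmetricAlgebra.ι ℂ V)

theorem dilation_inc_mul (t : ℝ) (v : V) (φ : Sym V) :
    dilation t (inc v * φ) = (t : ℂ) • (inc v * dilation t φ) := by
  rw [map_mul, ← smul_mul_assoc]
  congr 1
  simp [dilation]

theorem dilation_dilation (s t : ℝ) (φ : Sym V) :
    dilation s (dilation t φ) = dilation (s * t) φ := by
  induction φ using sym_induction with
  | one => simp
  | smul c a h => simp only [map_smul, h]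
  | add a b ha hb => simp only [map_add, ha, hb]
  | mul v a h =>
    simp only [dilation_inc_mul, map_smul, h, smul_smul, Complex.ofReal_mul, mul_comm (s : ℂ)]

theorem annihilator_dilation (t : ℝ) (v : V) (φ : Sym V) :
    annihilator v (dilation t φ) = (t : ℂ) • dilation t (annihilator v φ) := by
  induction φ using sym_induction with
  | one => simp
  | smul c a h => simp only [map_smul, Derivation.map_smul, h, smul_comm c]
  | add a b ha hb => simp only [map_add, ha, hb, smul_add]
  | mul w a h =>
    simp only [dilation_inc_mul, Derivation.map_smul, annihilator_inc_mul, h, map_add, map_smul,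
      smul_add, mul_smul_comm]

theorem inner_dilation (t : ℝ) (φ ψ : Sym V) :
    (inner ℂ (dilation t φ) ψ : ℂ) = inner ℂ φ (dilation t ψ) := by
  induction ψ using sym_induction generalizing φ with
  | one =>
    rw [map_one]
    induction φ using sym_induction with
    | one => simp
    | smul c a h => simp only [map_smul, inner_smul_left, h]
    | add a b ha hb => simp only [map_add, inner_add_left, ha, hb]
    | mul v a h => simp [dilation_inc_mul, inner_inc_mul]
  | smul c a h => simp only [map_smul, inner_smul_right, h]
  | add a b ha hb => simp only [map_add, inner_add_right, ha, hb]
  | mul v a h =>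
    rw [dilation_inc_mul, inner_smul_right, ← inner_annihilator, ← inner_annihilator,
      annihilator_dilation, inner_smul_left, h, Complex.conj_ofReal]

theorem dilation_homog {M : Submodule ℂ V} (t : ℝ) {d : ℕ} {φ : Sym V} (h : φ ∈ homog M d) :
    dilation t φ = (t : ℂ) ^ d • φ := by
  refine homog_induction (P := fun d φ => dilation t φ = (t : ℂ) ^ d • φ) ?_ ?_ ?_ h
  · intro c; simp
  · intro d a b ha hb; rw [map_add, ha, hb, smul_add]
  · intro d v a _ _ ha
    rw [dilation_inc_mul, ha, mul_smul_comm, smul_smul, pow_succ']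

theorem norm_dilation_le {t : ℝ} (h0 : 0 ≤ t) (h1 : t ≤ 1) (φ : Sym V) :
    ‖dilation t φ‖ ≤ ‖φ‖ := by
  have := norm_map_le_of_homog (dilation t (V := V)).toLinearMap zero_le_one ?_ ?_ φ
  · simpa using this
  · intro M _ d φ hφ
    change ‖dilation t φ‖ ^ 2 ≤ _
    rw [dilation_homog t hφ, norm_smul, norm_pow, Complex.norm_real, Real.norm_of_nonneg h0,
      mul_pow, one_pow]
    gcongr
    exact pow_le_one₀ (by positivity) (pow_le_one₀ h0 h1)
  · intro M _ d d' hd φ hφ ψ hψ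
    change (inner ℂ (dilation t φ) (dilation t ψ) : ℂ) = 0
    rw [dilation_homog t hφ, dilation_homog t hψ, inner_smul_left, inner_smul_right, sym_inner,
      pairing_homog_ne hd.symm hψ hφ, mul_zero, mul_zero]

theorem natCast_mul_pow_le {s : ℝ} (h0 : 0 ≤ s) (h1 : s < 1) (d : ℕ) :
    d * s ^ (d - 1) ≤ (1 - s)⁻¹ := by
  calc (d : ℝ) * s ^ (d - 1) = ∑ _k ∈ Finset.range d, s ^ (d - 1) := by simp
    _ ≤ ∑ k ∈ Finset.range d, s ^ k := by
        refine Finset.sum_le_sum fun k hk => pow_le_pow_of_le_one h0 h1.le ?_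
        have := Finset.mem_range.1 hk
        omega
    _ ≤ ∑' k : ℕ, s ^ k :=
        (summable_geometric_of_lt_one h0 h1).sum_le_tsum _ fun _ _ => by positivity
    _ = (1 - s)⁻¹ := tsum_geometric_of_lt_one h0 h1

/-- Smoothing by a dilation makes annihilators bounded: in degree `d` the norm of `Γ(t)a(v)` is at
most `√d tᵈ⁻¹ ‖v‖`. -/
theorem exists_norm_dilation_annihilator_le {t : ℝ} (h0 : 0 ≤ t) (h1 : t < 1) (v : V) :
    ∃ C, 0 ≤ C ∧ ∀ φ : Sym V, ‖dilation t (annihilator v φ)‖ ≤ C * ‖φ‖ := by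
  have hs : t ^ 2 < 1 := pow_lt_one₀ h0 h1 two_ne_zero
  have hC : 0 ≤ ‖v‖ ^ 2 * (1 - t ^ 2)⁻¹ := mul_nonneg (sq_nonneg _) (inv_nonneg.2 (by linarith))
  refine ⟨√(‖v‖ ^ 2 * (1 - t ^ 2)⁻¹), Real.sqrt_nonneg _, fun φ => ?_⟩
  refine norm_map_le_of_homog ((dilation t).toLinearMap ∘ₗ (annihilator v).toLinearMap)
    (Real.sqrt_nonneg _) ?_ ?_ φ
  · intro M _ d φ hφ
    change ‖dilation t (annihilator v φ)‖ ^ 2 ≤ _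
    rw [dilation_homog t (annihilator_mem_homog v hφ), norm_smul, norm_pow, Complex.norm_real,
      Real.norm_of_nonneg h0, mul_pow, ← pow_mul, mul_comm (d - 1) 2, pow_mul, Real.sq_sqrt hC]
    calc (t ^ 2) ^ (d - 1) * ‖annihilator v φ‖ ^ 2
        ≤ (t ^ 2) ^ (d - 1) * (‖v‖ ^ 2 * (d * ‖φ‖ ^ 2)) := by
          gcongr; exact norm_annihilator_homog_le v hφ
      _ = ‖v‖ ^ 2 * (d * (t ^ 2) ^ (d - 1)) * ‖φ‖ ^ 2 := by ring
      _ ≤ ‖v‖ ^ 2 * (1 - t ^ 2)⁻¹ * ‖φ‖ ^ 2 := by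
          gcongr; exact natCast_mul_pow_le (sq_nonneg t) hs d
  · intro M _ d d' hd φ hφ ψ hψ
    change (inner ℂ (dilation t (annihilator v φ)) (dilation t (annihilator v ψ)) : ℂ) = 0
    rcases Nat.eq_zero_or_pos d with rfl | hp
    · rw [annihilator_homog_zero v hφ, map_zero, inner_zero_left]
    rcases Nat.eq_zero_or_pos d' with rfl | hp'
    · rw [annihilator_homog_zero v hψ, map_zero, inner_zero_right]
    have hφ' := annihilator_mem_homog v hφ
    have hψ' := annihilator_mem_homog v hψ
    rw [dilation_homog t hφ', dilation_homog t hψ', inner_smul_left, inner_smul_right, sym_inner,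
      pairing_homog_ne (by omega) hψ' hφ', mul_zero, mul_zero]

theorem exists_norm_dilation_inc_mul_le {t : ℝ} (h0 : 0 ≤ t) (h1 : t < 1) (v : V) :
    ∃ C, 0 ≤ C ∧ ∀ φ : Sym V, ‖dilation t (inc v * φ)‖ ≤ C * ‖φ‖ := by
  obtain ⟨C, hC, h⟩ := exists_norm_dilation_annihilator_le h0 h1 v
  refine ⟨C, hC, fun φ => ?_⟩
  -- `Γ(t)c(v)` is the adjoint of `a(v)Γ(t) = t Γ(t)a(v)`.
  set χ := dilation t (inc v * φ) with hχ
  have h2 : ‖χ‖ * ‖χ‖ ≤ (C * ‖φ‖) * ‖χ‖ := by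
    calc ‖χ‖ * ‖χ‖ = ‖(inner ℂ χ χ : ℂ)‖ := by
          rw [inner_self_eq_norm_sq_to_K, norm_pow]
          simp [sq]
      _ = ‖(inner ℂ φ ((t : ℂ) • dilation t (annihilator v χ)) : ℂ)‖ := by
          conv_lhs => enter [1, 2]; rw [hχ]
          rw [inner_dilation, inner_inc_mul, annihilator_dilation]
      _ ≤ ‖φ‖ * ‖(t : ℂ) • dilation t (annihilator v χ)‖ := norm_inner_le_norm _ _
      _ ≤ ‖φ‖ * (1 * (C * ‖χ‖)) := by
          rw [norm_smul, Complex.norm_real, Real.norm_of_nonneg h0]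
          gcongr
          exact h χ
      _ = (C * ‖φ‖) * ‖χ‖ := by ring
  rcases (norm_nonneg χ).eq_or_lt with h3 | h3
  · rw [← h3]; positivity
  · exact le_of_mul_le_mul_right h2 h3

/-- `Γ(t)` as a bounded operator, for `0 ≤ t ≤ 1`. -/
theorem exists_dilation_clm {t : ℝ} (h0 : 0 ≤ t) (h1 : t ≤ 1) :
    ∃ T : Sym V →L[ℂ] Sym V, ∀ φ, T φ = dilation t φ :=
  ⟨(dilation t).toLinearMap.mkContinuous 1 fun φ => by
    simpa using norm_dilation_le h0 h1 φ, fun _ => rfl⟩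

/-- `Γ(t){c(x) + a(y)}` as a bounded operator, for `0 ≤ t < 1`. -/
theorem exists_dilation_field_clm {t : ℝ} (h0 : 0 ≤ t) (h1 : t < 1) (x y : V) :
    ∃ T : Sym V →L[ℂ] Sym V, ∀ φ, T φ = dilation t (inc x * φ + annihilator y φ) := by
  obtain ⟨C, -, hC⟩ := exists_norm_dilation_inc_mul_le h0 h1 x
  obtain ⟨D, -, hD⟩ := exists_norm_dilation_annihilator_le h0 h1 y
  refine ⟨((dilation t).toLinearMap ∘ₗ (creator x + (annihilator y).toLinearMap)).mkContinuous
    (C + D) fun φ => ?_, fun _ => rfl⟩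
  change ‖dilation t (inc x * φ + annihilator y φ)‖ ≤ _
  rw [map_add, add_mul]
  exact (norm_add_le _ _).trans (add_le_add (hC φ) (hD φ))

end Dilation

/-! ### Analytic vectors -/

section Analytic

variable {V : Type*} [NormedAddCommGroup V] [InnerProductSpace ℂ V]

/-- An antifunctional is analytic when it is `Γ(t)Φ'` for some `Φ'` in Fock space and some
`0 < t < 1`. -/
def IsAnalytic (Φ : AntiDual V) : Prop :=
  ∃ t : ℝ, 0 < t ∧ t < 1 ∧ ∃ Φ' : Fock V, ∀ ψ, Φ ψ = Φ' (dilation t ψ)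

theorem IsAnalytic.exists_fock {Φ : AntiDual V} (h : IsAnalytic Φ) :
    ∃ Ψ : Fock V, (Ψ : AntiDual V) = Φ := by
  obtain ⟨t, h0, h1, Φ', h⟩ := h
  obtain ⟨T, hT⟩ := exists_dilation_clm (V := V) h0.le h1.le
  refine ⟨Φ'.comp T, ?_⟩
  ext ψ
  rw [h, ← hT]
  rfl

theorem IsAnalytic.smul {Φ : AntiDual V} (h : IsAnalytic Φ) (c : ℂ) : IsAnalytic (c • Φ) := by
  obtain ⟨t, h0, h1, Φ', h⟩ := h
  exact ⟨t, h0, h1, c • Φ', fun ψ => by simp [h]⟩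

theorem IsAnalytic.exists_of_le {Φ : AntiDual V} {s t : ℝ} (hs : 0 < s) (hst : s ≤ t)
    {Φ' : Fock V} (h : ∀ ψ, Φ ψ = Φ' (dilation s ψ)) :
    ∃ Φ'' : Fock V, ∀ ψ, Φ ψ = Φ'' (dilation t ψ) := by
  have ht := hs.trans_le hst
  obtain ⟨T, hT⟩ := exists_dilation_clm (V := V) (div_nonneg hs.le ht.le) ((div_le_one ht).2 hst)
  refine ⟨Φ'.comp T, fun ψ => ?_⟩
  rw [ContinuousLinearMap.comp_apply, hT, dilation_dilation, div_mul_cancel₀ _ ht.ne', h]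

theorem IsAnalytic.add {Φ Ψ : AntiDual V} (hΦ : IsAnalytic Φ) (hΨ : IsAnalytic Ψ) :
    IsAnalytic (Φ + Ψ) := by
  obtain ⟨s, hs0, hs1, Φ', hΦ⟩ := hΦ
  obtain ⟨t, ht0, ht1, Ψ', hΨ⟩ := hΨ
  obtain ⟨Φ'', h⟩ := IsAnalytic.exists_of_le hs0 (le_max_left s t) hΦ
  obtain ⟨Ψ'', h'⟩ := IsAnalytic.exists_of_le ht0 (le_max_right s t) hΨ
  exact ⟨max s t, lt_max_of_lt_left hs0, max_lt hs1 ht1, Φ'' + Ψ'', fun ψ => by simp [h, h']⟩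

theorem IsAnalytic.antiAnnihilator_add_antiCreator {Φ : AntiDual V} (h : IsAnalytic Φ) (x y : V) :
    IsAnalytic (antiAnnihilator x Φ + antiCreator y Φ) := by
  obtain ⟨t, h0, h1, Φ', h⟩ := h
  -- half of the smoothing `Γ(t) = Γ(√t)²` absorbs the unbounded operators
  have hs0 : 0 < √t := Real.sqrt_pos.2 h0
  have hs1 : √t < 1 := by rw [Real.sqrt_lt' one_pos]; simpa using h1
  obtain ⟨T, hT⟩ := exists_dilation_field_clm (V := V) hs0.le hs1 (((√t : ℝ) : ℂ) • x)
    (((√t : ℝ) : ℂ)⁻¹ • y)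
  have hs : ((√t : ℝ) : ℂ) ≠ 0 := by exact_mod_cast hs0.ne'
  refine ⟨√t, hs0, hs1, Φ'.comp T, fun ψ => ?_⟩
  have key : inc (((√t : ℝ) : ℂ) • x) * dilation (√t) ψ +
      annihilator (((√t : ℝ) : ℂ)⁻¹ • y) (dilation (√t) ψ) =
      dilation (√t) (inc x * ψ + annihilator y ψ) := by
    rw [annihilator_smul, annihilator_dilation, map_add, dilation_inc_mul, map_inv₀,
      Complex.conj_ofReal, smul_smul, inv_mul_cancel₀ hs, one_smul, inc, map_smul, smul_mul_assoc]
  rw [ContinuousLinearMap.comp_apply, hT, key, dilation_dilation, Real.mul_self_sqrt h0.le, ← h,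
    map_add]
  rfl

/-- For an analytic `Φ` the formal adjoint relation between `c(x) + a(y)` and `a(x) + c(y)` holds
against every `Ψ` in Fock space that `c(y) + a(x)`, acting on the antidual, keeps in Fock space:
both sides are continuous in `Φ'`, where `Φ = Γ(t)Φ'`, and agree for `Φ'` in the dense subspace
`SV`. -/
theorem IsAnalytic.inner_eq {Φ Φ₁ Ψ Ψ₁ : Fock V} (hΦ : IsAnalytic (Φ : AntiDual V)) (x y : V)
    (h1 : ∀ ψ, Φ₁ ψ = Φ (inc x * ψ) + Φ (annihilator y ψ))
    (h2 : ∀ ψ, Ψ₁ ψ = Ψ (annihilator x ψ) + Ψ (inc y * ψ)) :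
    (inner ℂ Φ₁ Ψ : ℂ) = inner ℂ Φ Ψ₁ := by
  obtain ⟨t, ht0, ht1, Φ', h⟩ := hΦ
  have h : ∀ ψ, Φ ψ = Φ' (dilation t ψ) := h
  obtain ⟨G, hG⟩ := exists_dilation_clm (V := V) ht0.le ht1.le
  obtain ⟨T, hT⟩ := exists_dilation_field_clm (V := V) ht0.le ht1 x y
  have key : ∀ Φ' : Fock V, (inner ℂ (Φ'.comp T) Ψ : ℂ) = inner ℂ (Φ'.comp G) Ψ₁ := by
    intro Φ'
    refine denseRange_toFock.induction_on (p := fun Φ' : Fock V =>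
      (inner ℂ (Φ'.comp T) Ψ : ℂ) = inner ℂ (Φ'.comp G) Ψ₁) Φ' ?_ ?_
    · have hc : ∀ S : Sym V →L[ℂ] Sym V, Continuous fun Φ' : Fock V => Φ'.comp S := fun S =>
        ((ContinuousLinearMap.compSL (Sym V) (Sym V) ℂ (RingHom.id ℂ)
          (starRingEnd ℂ)).flip S).continuous
      exact isClosed_eq ((hc T).inner continuous_const) ((hc G).inner continuous_const)
    · intro φ
      have e1 : (toFock φ).comp G = toFock (dilation t φ) := by
        ext ψ
        change (inner ℂ (G ψ) φ : ℂ) = inner ℂ ψ (dilation t φ)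
        rw [hG, inner_dilation]
      have e2 : (toFock φ).comp T =
          toFock (annihilator x (dilation t φ) + inc y * dilation t φ) := by
        ext ψ
        change (inner ℂ (T ψ) φ : ℂ) = inner ℂ ψ _
        rw [hT, inner_dilation, inner_add_left, inner_add_right, inner_inc_mul,
          inner_annihilator]
      rw [e1, e2, inner_toFock, inner_toFock, h2, map_add]
  have e1 : Φ = Φ'.comp G := by
    ext ψ
    rw [h, ← hG]
    rfl
  have e2 : Φ₁ = Φ'.comp T := by
    ext ψ
    rw [h1, h, h, ← map_add, ← map_add, ← hT]
    rfl
  rw [e1, e2, key]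

end Analytic

/-! ### Gaussians of compressions -/

section FiniteRank

variable {V : Type*} [NormedAddCommGroup V] [InnerProductSpace ℂ V]
  {M : Submodule ℂ V} {ι : Type*} [Fintype ι]

theorem norm_sq_eq_sum_inner_coe (e : OrthonormalBasis ι ℂ M) {y : V} (hy : y ∈ M) :
    ‖y‖ ^ 2 = ∑ i, ‖(inner ℂ (e i : V) y : ℂ)‖ ^ 2 :=
  (e.sum_sq_norm_inner_right (⟨y, hy⟩ : M)).symm

theorem sum_inner_mul_inner_coe (e : OrthonormalBasis ι ℂ M) {x : V} (hx : x ∈ M) (y : V) :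
    ∑ i, (inner ℂ x (e i : V) : ℂ) * inner ℂ (e i : V) y = inner ℂ x y := by
  conv_rhs => rw [← sum_inner_smul_coe e hx]
  simp only [sum_inner, inner_smul_left, inner_conj_symm]

/-- A scalar matrix acts on tuples of vectors of an inner product space with the same bound as on
tuples of scalars. -/
theorem sum_norm_sq_matrix_le {E : Type*} [NormedAddCommGroup E] [InnerProductSpace ℂ E]
    (m : ι → ι → ℂ) {T : ℝ}
    (hm : ∀ c : ι → ℂ, ∑ i, ‖∑ j, m i j * c j‖ ^ 2 ≤ T * ∑ j, ‖c j‖ ^ 2) (x : ι → E) :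
    ∑ i, ‖∑ j, m i j • x j‖ ^ 2 ≤ T * ∑ j, ‖x j‖ ^ 2 := by
  let X : Submodule ℂ E := Submodule.span ℂ (Set.range x)
  have : FiniteDimensional ℂ X := FiniteDimensional.span_of_finite ℂ (Set.finite_range x)
  let f := stdOrthonormalBasis ℂ X
  have hx : ∀ j, x j ∈ X := fun j => Submodule.subset_span ⟨j, rfl⟩
  have hs : ∀ i, ∑ j, m i j • x j ∈ X := fun i =>
    Submodule.sum_mem _ fun j _ => Submodule.smul_mem _ _ (hx j)
  calc ∑ i, ‖∑ j, m i j • x j‖ ^ 2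
      = ∑ k, ∑ i, ‖∑ j, m i j * (inner ℂ (f k : E) (x j) : ℂ)‖ ^ 2 := by
        rw [Finset.sum_comm]
        refine Finset.sum_congr rfl fun i _ => ?_
        rw [norm_sq_eq_sum_inner_coe f (hs i)]
        simp only [inner_sum, inner_smul_right]
    _ ≤ ∑ k, T * ∑ j, ‖(inner ℂ (f k : E) (x j) : ℂ)‖ ^ 2 :=
        Finset.sum_le_sum fun k _ => hm _
    _ = T * ∑ j, ‖x j‖ ^ 2 := by
        rw [← Finset.mul_sum, Finset.sum_comm]
        congr 1
        exact Finset.sum_congr rfl fun j _ => (norm_sq_eq_sum_inner_coe f (hx j)).symm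

/-- The compression of `Z` to the subspace `M` with orthonormal basis `e`: the orthogonal projection
of `Z v` to `M`. -/
def compression (e : OrthonormalBasis ι ℂ M) (Z : V →ₗ⋆[ℂ] V) (v : V) : V :=
  ∑ j, (inner ℂ (e j : V) (Z v) : ℂ) • (e j : V)

theorem compression_mem (e : OrthonormalBasis ι ℂ M) (Z : V →ₗ⋆[ℂ] V) (v : V) :
    compression e Z v ∈ M :=
  Submodule.sum_mem _ fun j _ => Submodule.smul_mem _ _ (e j).2

theorem inner_compression (e : OrthonormalBasis ι ℂ M) (Z : V →ₗ⋆[ℂ] V) (v : V) {x : V}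
    (hx : x ∈ M) : (inner ℂ x (compression e Z v) : ℂ) = inner ℂ x (Z v) := by
  rw [compression, inner_sum, ← sum_inner_mul_inner_coe e hx]
  simp only [inner_smul_right, mul_comm]

theorem norm_compression_le (e : OrthonormalBasis ι ℂ M) (Z : V →ₗ⋆[ℂ] V) (v : V) :
    ‖compression e Z v‖ ^ 2 ≤ ‖Z v‖ ^ 2 := by
  rw [norm_sq_eq_sum_inner_coe e (compression_mem e Z v)]
  simp only [inner_compression e Z v (e _).2]
  exact (orthonormal_coe e).sum_inner_products_le _

theorem annihilator_compression (e : OrthonormalBasis ι ℂ M) (Z : V →ₗ⋆[ℂ] V) (v : V) {d : ℕ}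
    {φ : Sym V} (h : φ ∈ homog M d) :
    annihilator (compression e Z v) φ = annihilator (Z v) φ := by
  rw [annihilator_eq_sum e _ h, annihilator_eq_sum e (Z v) h]
  refine Finset.sum_congr rfl fun i _ => ?_
  rw [← inner_conj_symm, inner_compression e Z v (e i).2, inner_conj_symm]

/-- The element of `S²M` that represents the compression of the quadratic `ζ` to `M`. -/
def quadElem (e : OrthonormalBasis ι ℂ M) (Z : V →ₗ⋆[ℂ] V) : Sym V :=
  (2⁻¹ : ℂ) • ∑ i, inc (e i : V) * inc (compression e Z (e i : V))

theorem inc_mem_homog {v : V} (hv : v ∈ M) : inc v ∈ homog M 1 := by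
  have := inc_mul_mem_homog (φ := (1 : Sym V)) (d := 0) hv (by simp [homog])
  simpa using this

theorem quadElem_mem (e : OrthonormalBasis ι ℂ M) (Z : V →ₗ⋆[ℂ] V) :
    quadElem e Z ∈ homog M 2 :=
  Submodule.smul_mem _ _ <| Submodule.sum_mem _ fun i _ =>
    inc_mul_mem_homog (e i).2 (inc_mem_homog (compression_mem e Z _))

theorem annihilator_quadElem (e : OrthonormalBasis ι ℂ M) (Z : V →ₗ⋆[ℂ] V)
    (hZ : ∀ x y, (inner ℂ y (Z x) : ℂ) = inner ℂ x (Z y)) {v : V} (hv : v ∈ M) :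
    annihilator v (quadElem e Z) = inc (compression e Z v) := by
  have h1 : ∑ i, (inner ℂ v (e i : V) : ℂ) • compression e Z (e i : V) = compression e Z v := by
    simp only [compression, Finset.smul_sum, smul_smul]
    rw [Finset.sum_comm]
    refine Finset.sum_congr rfl fun j _ => ?_
    rw [← Finset.sum_smul]
    congr 1
    rw [hZ v (e j : V), ← sum_inner_mul_inner_coe e hv]
    exact Finset.sum_congr rfl fun i _ => by rw [hZ (e i : V) (e j : V)]
  have h2 : ∑ i, (inner ℂ v (compression e Z (e i : V)) : ℂ) • (e i : V) = compression e Z v :=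
    Finset.sum_congr rfl fun i _ => by rw [inner_compression e Z _ hv, hZ]
  have h1' := congrArg (SymmetricAlgebra.ι ℂ V) h1
  have h2' := congrArg (SymmetricAlgebra.ι ℂ V) h2
  simp only [map_sum, map_smul] at h1' h2'
  have h3 : ∀ i, annihilator v (inc (e i : V) * inc (compression e Z (e i : V))) =
      (inner ℂ v (e i : V) : ℂ) • inc (compression e Z (e i : V)) +
        (inner ℂ v (compression e Z (e i : V)) : ℂ) • inc (e i : V) := fun i => by
    rw [annihilator_inc_mul, annihilator_inc, Algebra.algebraMap_eq_smul_one, mul_smul_comm,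
      mul_one]
  rw [quadElem, Derivation.map_smul, map_sum]
  simp only [h3, Finset.sum_add_distrib, h1', h2']
  rw [← two_smul ℂ, smul_smul]
  simp

/-- The degree `2n` part of the Gaussian of the compression of `Z` to `M`. -/
def gaussPart (e : OrthonormalBasis ι ℂ M) (Z : V →ₗ⋆[ℂ] V) (n : ℕ) : Sym V :=
  ((n.factorial : ℂ)⁻¹) • quadElem e Z ^ n

theorem gaussPart_zero (e : OrthonormalBasis ι ℂ M) (Z : V →ₗ⋆[ℂ] V) : gaussPart e Z 0 = 1 := by
  simp [gaussPart]

theorem gaussPart_mem (e : OrthonormalBasis ι ℂ M) (Z : V →ₗ⋆[ℂ] V) (n : ℕ) :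
    gaussPart e Z n ∈ homog M (2 * n) := by
  refine Submodule.smul_mem _ _ ?_
  rw [homog, pow_mul]
  exact Submodule.pow_mem_pow _ (quadElem_mem e Z) n

theorem annihilator_gaussPart (e : OrthonormalBasis ι ℂ M) (Z : V →ₗ⋆[ℂ] V)
    (hZ : ∀ x y, (inner ℂ y (Z x) : ℂ) = inner ℂ x (Z y)) {v : V} (hv : v ∈ M) (n : ℕ) :
    annihilator v (gaussPart e Z (n + 1)) = inc (compression e Z v) * gaussPart e Z n := by
  have h1 : ((n : ℂ) + 1) ≠ 0 := by exact_mod_cast Nat.succ_ne_zero n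
  rw [gaussPart, Derivation.map_smul, Derivation.leibniz_pow, annihilator_quadElem e Z hZ hv,
    gaussPart, Nat.add_sub_cancel, ← Nat.cast_smul_eq_nsmul ℂ, smul_smul, smul_eq_mul,
    mul_smul_comm, mul_comm (quadElem e Z ^ n), Nat.factorial_succ]
  congr 1
  push_cast
  field_simp

/-- On `SᵈM` the Gaussian of `Z` is represented by the Gaussian of the compression to `M`, cut off
in high degree. -/
theorem gaussian_eq_sum_gaussPart (e : OrthonormalBasis ι ℂ M) (Z : V →ₗ⋆[ℂ] V)
    (hZ : ∀ x y, (inner ℂ y (Z x) : ℂ) = inner ℂ x (Z y)) {d : ℕ} {φ : Sym V}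
    (h : φ ∈ homog M d) {N : ℕ} (hN : d < 2 * N) :
    gaussian Z φ = ∑ n ∈ Finset.range N, pairing (gaussPart e Z n) φ := by
  have : FiniteDimensional ℂ M := Module.Finite.of_basis e.toBasis
  induction d using Nat.strong_induction_on generalizing φ N with
  | _ d ih =>
    refine homog_induction (P := fun d φ => (∀ m < d, ∀ {φ : Sym V}, φ ∈ homog M m → ∀ {N : ℕ},
      m < 2 * N → gaussian Z φ = ∑ n ∈ Finset.range N, pairing (gaussPart e Z n) φ) →
        ∀ N, d < 2 * N → gaussian Z φ = ∑ n ∈ Finset.range N, pairing (gaussPart e Z n) φ)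
      ?_ ?_ ?_ h ih N hN
    · intro c _ N hN
      obtain ⟨K, rfl⟩ : ∃ K, N = K + 1 := ⟨N - 1, by omega⟩
      have h0 : ∀ n, pairing (gaussPart e Z (n + 1)) (1 : Sym V) = 0 := fun n =>
        pairing_homog_ne (M := M) (d' := 0) (by omega) (gaussPart_mem e Z (n + 1)) (by simp [homog])
      rw [Finset.sum_range_succ']
      simp only [LinearMap.map_smulₛₗ, h0, gaussian_one, gaussPart_zero, pairing_one]
      simp
    · intro d a b ha hb IH N hN
      simp only [map_add, Finset.sum_add_distrib, ha IH N hN, hb IH N hN]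
    · intro d v a hv ha _ IH N hN
      obtain ⟨K, rfl⟩ : ∃ K, N = K + 1 := ⟨N - 1, by omega⟩
      rw [gaussian_inc_mul Z hZ, ← annihilator_compression e Z v ha, Finset.sum_range_succ']
      simp only [pairing_inc_mul_right, annihilator_gaussPart e Z hZ hv, gaussPart_zero,
        Derivation.map_one_eq_zero, map_zero, LinearMap.zero_apply, add_zero, pairing_inc_mul]
      rcases Nat.eq_zero_or_pos d with rfl | hd
      · simp [annihilator_homog_zero _ ha]
      · exact IH (d - 1) (by omega) (annihilator_mem_homog _ ha) (by omega)

/-- The norm recursion for the parts of a Gaussian, from counting degrees: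
`2(n + 1)‖Gₙ₊₁‖² = ∑ᵢ ‖c(PZeᵢ)Gₙ‖² = ∑ᵢ (‖PZeᵢ‖²‖Gₙ‖² + ‖a(PZeᵢ)Gₙ‖²)`, with `P` the projection
to `M`. -/
theorem norm_sq_gaussPart_succ_le (e : OrthonormalBasis ι ℂ M) (Z : V →ₗ⋆[ℂ] V)
    (hZ : ∀ x y, (inner ℂ y (Z x) : ℂ) = inner ℂ x (Z y)) {t h : ℝ} (ht : ∀ x, ‖Z x‖ ≤ t * ‖x‖)
    (hh : ∑ i, ‖Z (e i : V)‖ ^ 2 ≤ h) (n : ℕ) :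
    2 * (n + 1) * ‖gaussPart e Z (n + 1)‖ ^ 2 ≤ (h + 2 * n * t ^ 2) * ‖gaussPart e Z n‖ ^ 2 := by
  have h1 := sum_norm_sq_annihilator e (gaussPart_mem e Z (n + 1))
  have h2 := sum_norm_sq_annihilator e (gaussPart_mem e Z n)
  simp only [annihilator_gaussPart e Z hZ (e _).2, norm_sq_inc_mul, Finset.sum_add_distrib,
    ← Finset.sum_mul] at h1
  have h3 : ∑ i, ‖compression e Z (e i : V)‖ ^ 2 ≤ h :=
    (Finset.sum_le_sum fun i _ => norm_compression_le e Z _).trans hh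
  have h4 : ∑ i, ‖annihilator (compression e Z (e i : V)) (gaussPart e Z n)‖ ^ 2 ≤
      t ^ 2 * ∑ i, ‖annihilator (e i : V) (gaussPart e Z n)‖ ^ 2 := by
    simp only [annihilator_compression e Z _ (gaussPart_mem e Z n)]
    simp only [annihilator_eq_sum e (Z _) (gaussPart_mem e Z n)]
    refine sum_norm_sq_matrix_le (fun i j => inner ℂ (Z (e i : V)) (e j : V)) (fun c => ?_) _
    -- with `u = ∑ cⱼeⱼ` this is `∑ᵢ |⟨eᵢ | Zu⟩|² ≤ t²‖u‖²`
    let u : V := ∑ j, c j • (e j : V)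
    have hu : ‖u‖ ^ 2 = ∑ j, ‖c j‖ ^ 2 := by
      rw [norm_sq_eq_sum_inner_coe e (Submodule.sum_mem _ fun j _ =>
        Submodule.smul_mem _ _ (e j).2 : u ∈ M)]
      refine Finset.sum_congr rfl fun j _ => ?_
      rw [(orthonormal_coe e).inner_right_fintype c j]
    calc ∑ i, ‖∑ j, (inner ℂ (Z (e i : V)) (e j : V) : ℂ) * c j‖ ^ 2
        = ∑ i, ‖(inner ℂ (e i : V) (Z u) : ℂ)‖ ^ 2 := by
          refine Finset.sum_congr rfl fun i _ => ?_
          rw [← hZ, ← norm_inner_symm]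
          simp only [u, inner_sum, inner_smul_right, mul_comm]
      _ ≤ ‖Z u‖ ^ 2 := (orthonormal_coe e).sum_inner_products_le _
      _ ≤ (t * ‖u‖) ^ 2 := by gcongr; exact ht u
      _ = t ^ 2 * ∑ j, ‖c j‖ ^ 2 := by rw [mul_pow, hu]
  rw [h2] at h4
  push_cast at h1 h4
  calc 2 * ((n : ℝ) + 1) * ‖gaussPart e Z (n + 1)‖ ^ 2 ≤
      h * ‖gaussPart e Z n‖ ^ 2 + t ^ 2 * (2 * n * ‖gaussPart e Z n‖ ^ 2) := by
        rw [← h1]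
        gcongr
    _ = _ := by ring

theorem norm_one_sym : ‖(1 : Sym V)‖ = 1 := by
  have h := sym_norm_sq (1 : Sym V)
  rw [pairing_one, vacuum_one] at h
  have h' : ‖(1 : Sym V)‖ ^ 2 = 1 := by exact_mod_cast h
  exact (pow_eq_one_iff_of_nonneg (norm_nonneg _) two_ne_zero).1 h'

/-- The `n`th term of the binomial series of `(1 - t²)^(-h / 2t²)`, which dominates the squared
norm of the degree `2n` part of a Gaussian. -/
def gaussCoeff (t h : ℝ) (n : ℕ) : ℝ :=
  ∏ k ∈ Finset.range n, (h + 2 * k * t ^ 2) / (2 * (k + 1))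

theorem gaussCoeff_nonneg {t h : ℝ} (h0 : 0 ≤ h) (n : ℕ) : 0 ≤ gaussCoeff t h n :=
  Finset.prod_nonneg fun k _ => by positivity

theorem summable_gaussCoeff {t h : ℝ} (h0 : 0 ≤ h) (ht0 : 0 ≤ t) (ht : t < 1) :
    Summable (gaussCoeff t h) := by
  have hs : t ^ 2 < 1 := pow_lt_one₀ ht0 ht two_ne_zero
  refine summable_of_ratio_norm_eventually_le (r := (1 + t ^ 2) / 2) (by linarith) ?_
  obtain ⟨N, hN⟩ := exists_nat_ge (h / (1 - t ^ 2))
  filter_upwards [Filter.eventually_ge_atTop N] with n hn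
  have hn' : h ≤ n * (1 - t ^ 2) := by
    rw [← div_le_iff₀ (by linarith)]
    exact hN.trans (by exact_mod_cast hn)
  rw [Real.norm_of_nonneg (gaussCoeff_nonneg h0 _), Real.norm_of_nonneg (gaussCoeff_nonneg h0 _),
    gaussCoeff, Finset.prod_range_succ, ← gaussCoeff, mul_comm]
  refine mul_le_mul_of_nonneg_right ?_ (gaussCoeff_nonneg h0 _)
  rw [div_le_iff₀ (by positivity)]
  nlinarith [sq_nonneg t]

theorem norm_sq_gaussPart_le (e : OrthonormalBasis ι ℂ M) (Z : V →ₗ⋆[ℂ] V)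
    (hZ : ∀ x y, (inner ℂ y (Z x) : ℂ) = inner ℂ x (Z y)) {t h : ℝ} (ht : ∀ x, ‖Z x‖ ≤ t * ‖x‖)
    (h0 : 0 ≤ h) (hh : ∑ i, ‖Z (e i : V)‖ ^ 2 ≤ h) (n : ℕ) :
    ‖gaussPart e Z n‖ ^ 2 ≤ gaussCoeff t h n := by
  induction n with
  | zero => simp [gaussPart_zero, norm_one_sym, gaussCoeff]
  | succ n ih =>
    rw [gaussCoeff, Finset.prod_range_succ, ← gaussCoeff, ← mul_div_assoc,
      le_div_iff₀ (by positivity), mul_comm]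
    refine (norm_sq_gaussPart_succ_le e Z hZ ht hh n).trans ?_
    rw [mul_comm]
    gcongr

end FiniteRank

/-! ### Boundedness of Gaussians -/

section Bounded

variable {V : Type*} [NormedAddCommGroup V] [InnerProductSpace ℂ V]

/-- `∑ ‖T fᵢ‖² ≤ h` for every finite orthonormal family `f`. -/
def HSBound (T : V → V) (h : ℝ) : Prop :=
  ∀ (n : ℕ) (f : Fin n → V), Orthonormal ℂ f → ∑ i, ‖T (f i)‖ ^ 2 ≤ h

/-- The Gaussian of a Hilbert-Schmidt `Z` of operator norm less than one is bounded. -/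
theorem exists_norm_gaussian_le (Z : V →ₗ⋆[ℂ] V)
    (hZ : ∀ x y, (inner ℂ y (Z x) : ℂ) = inner ℂ x (Z y)) {t h : ℝ} (ht0 : 0 ≤ t) (ht1 : t < 1)
    (ht : ∀ x, ‖Z x‖ ≤ t * ‖x‖) (hh : HSBound Z h) :
    ∃ K, ∀ ψ : Sym V, ‖gaussian Z ψ‖ ≤ K * ‖ψ‖ := by
  have h0 : 0 ≤ h := by simpa using hh 0 (fun i => i.elim0) ⟨fun i => i.elim0, fun i => i.elim0⟩
  refine ⟨√(∑' n, gaussCoeff t h n), fun ψ => ?_⟩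
  obtain ⟨M, hM, hψ⟩ := exists_homog ψ
  obtain ⟨f, hf, rfl⟩ := (Submodule.mem_iSup_iff_exists_finsupp _ _).1 hψ
  let e := stdOrthonormalBasis ℂ M
  obtain ⟨N, hN⟩ : ∃ N, ∀ d ∈ f.support, d < 2 * N :=
    ⟨f.support.sup id + 1, fun d hd => by
      have : d ≤ f.support.sup id := Finset.le_sup (f := id) hd
      omega⟩
  have h1 : gaussian Z (f.sum fun _ x => x) =
      inner ℂ (f.sum fun _ x => x) (∑ n ∈ Finset.range N, gaussPart e Z n) := by
    rw [sym_inner, map_sum, LinearMap.sum_apply, Finsupp.sum]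
    simp only [map_sum]
    rw [Finset.sum_comm]
    exact Finset.sum_congr rfl fun d hd => gaussian_eq_sum_gaussPart e Z hZ (hf d) (hN d hd)
  have h2 : ‖∑ n ∈ Finset.range N, gaussPart e Z n‖ ≤ √(∑' n, gaussCoeff t h n) := by
    refine Real.le_sqrt_of_sq_le ?_
    rw [norm_sq_sum_of_orthogonal]
    · refine (Finset.sum_le_sum fun n _ => norm_sq_gaussPart_le e Z hZ ht h0
        (hh _ _ (orthonormal_coe e)) n).trans ?_
      exact (summable_gaussCoeff h0 ht0 ht1).sum_le_tsum _ fun n _ => gaussCoeff_nonneg h0 n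
    · intro m n hmn
      rw [sym_inner]
      exact pairing_homog_ne (by omega) (gaussPart_mem e Z n) (gaussPart_mem e Z m)
  rw [h1, mul_comm]
  refine (norm_inner_le_norm _ _).trans ?_
  gcongr

/-- The Gaussian stays bounded when `Z` is enlarged a little, so it is an analytic vector. -/
theorem isAnalytic_gaussian (Z : V →ₗ⋆[ℂ] V)
    (hZ : ∀ x y, (inner ℂ y (Z x) : ℂ) = inner ℂ x (Z y)) {t h : ℝ} (ht0 : 0 ≤ t) (ht1 : t < 1)
    (ht : ∀ x, ‖Z x‖ ≤ t * ‖x‖) (hh : HSBound Z h) : IsAnalytic (gaussian Z) := by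
  -- for `r > 1` with `r²t < 1`, `e^Z` is the image under `Γ(r⁻¹)` of the Gaussian of `r²Z`
  obtain ⟨s, hs0, hs1, hst⟩ : ∃ s : ℝ, 0 < s ∧ s < 1 ∧ t < s ^ 2 := by
    refine ⟨√((1 + t) / 2), Real.sqrt_pos.2 (by linarith), ?_, ?_⟩
    · rw [Real.sqrt_lt' one_pos]; linarith
    · rw [Real.sq_sqrt (by linarith)]; linarith
  let Y : V →ₗ⋆[ℂ] V := (((s ^ 2)⁻¹ : ℝ) : ℂ) • Z
  have hY : ∀ x, Y x = (((s ^ 2)⁻¹ : ℝ) : ℂ) • Z x := fun _ => rfl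
  have hYn : ∀ x, ‖Y x‖ = (s ^ 2)⁻¹ * ‖Z x‖ := fun x => by
    rw [hY, norm_smul, Complex.norm_real, Real.norm_of_nonneg (by positivity)]
  have hYs : ∀ x y, (inner ℂ y (Y x) : ℂ) = inner ℂ x (Y y) := fun x y => by
    rw [hY, hY, inner_smul_right, inner_smul_right, hZ]
  obtain ⟨K, hK⟩ := exists_norm_gaussian_le Y hYs (t := (s ^ 2)⁻¹ * t) (h := ((s ^ 2)⁻¹) ^ 2 * h)
    (by positivity) (by rw [inv_mul_lt_iff₀ (by positivity)]; linarith)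
    (fun x => by rw [hYn, mul_assoc]; gcongr; exact ht x)
    (fun n f hf => by
      simp only [hYn, mul_pow, ← Finset.mul_sum]
      gcongr
      exact hh n f hf)
  refine ⟨s, hs0, hs1, (gaussian Y).mkContinuous K hK, fun ψ => ?_⟩
  let Φ : AntiDual V := (gaussian Y).comp (dilation s).toLinearMap
  have hΦ : ∀ ψ, Φ ψ = gaussian Y (dilation s ψ) := fun _ => rfl
  change _ = gaussian Y (dilation s ψ)
  rw [← hΦ]
  congr 1
  refine antiDual_ext_of_inc_mul (Z := Z) ?_ (gaussian_inc_mul Z hZ) fun v θ => ?_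
  · rw [hΦ, map_one (dilation s), gaussian_one, gaussian_one]
  · have hs : (s : ℂ) ≠ 0 := by exact_mod_cast hs0.ne'
    rw [hΦ, hΦ, dilation_inc_mul, LinearMap.map_smulₛₗ, gaussian_inc_mul Y hYs, hY,
      annihilator_smul, annihilator_dilation, smul_smul, LinearMap.map_smulₛₗ, smul_smul]
    convert one_smul ℂ _
    simp only [map_mul, Complex.conj_ofReal]
    push_cast
    field_simp

/-- If the Gaussian of `Z` is bounded, then `Z` is Hilbert-Schmidt: test the Gaussian on the
compressions of the quadratic to finite-dimensional subspaces. -/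
theorem hsBound_of_norm_gaussian_le (Z : V →ₗ⋆[ℂ] V)
    (hZ : ∀ x y, (inner ℂ y (Z x) : ℂ) = inner ℂ x (Z y)) {K : ℝ}
    (hK : ∀ ψ : Sym V, ‖gaussian Z ψ‖ ≤ K * ‖ψ‖) : HSBound Z (2 * K ^ 2) := by
  intro n f hf
  let M : Submodule ℂ V := Submodule.span ℂ (Set.range f ∪ Set.range fun i => Z (f i))
  have : FiniteDimensional ℂ M :=
    FiniteDimensional.span_of_finite ℂ ((Set.finite_range _).union (Set.finite_range _))
  let e := stdOrthonormalBasis ℂ M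
  set S := ∑ i, ‖compression e Z (e i : V)‖ ^ 2 with hS
  have h1 : 2 * ‖quadElem e Z‖ ^ 2 = S := by
    have h := sum_norm_sq_annihilator e (quadElem_mem e Z)
    simp only [annihilator_quadElem e Z hZ (e _).2] at h
    rw [← Nat.cast_two, ← h]
    refine Finset.sum_congr rfl fun i _ => ?_
    have := norm_sq_inc_mul (compression e Z (e i : V)) 1
    simpa [norm_one_sym] using this
  have h2 : gaussian Z (quadElem e Z) = ((S / 2 : ℝ) : ℂ) := by
    have h : ∀ i, gaussian Z (inc (e i : V) * inc (compression e Z (e i : V))) =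
        ((‖compression e Z (e i : V)‖ ^ 2 : ℝ) : ℂ) := fun i => by
      rw [gaussian_inc_mul Z hZ, annihilator_inc, Algebra.algebraMap_eq_smul_one,
        LinearMap.map_smulₛₗ, inner_conj_symm, gaussian_one, smul_eq_mul, mul_one,
        ← inner_compression e Z _ (compression_mem e Z _), inner_self_eq_norm_sq_to_K]
      push_cast
      rfl
    rw [quadElem, LinearMap.map_smulₛₗ, map_sum, Finset.sum_congr rfl fun i _ => h i]
    have h2 : conj (2⁻¹ : ℂ) = 2⁻¹ := by rw [map_inv₀, map_ofNat]
    rw [h2]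
    simp [S, div_eq_inv_mul]
  have hS0 : 0 ≤ S := Finset.sum_nonneg fun i _ => sq_nonneg _
  have h3 := hK (quadElem e Z)
  rw [h2, Complex.norm_real, Real.norm_of_nonneg (by positivity), ← h1] at h3
  have h4 : ‖quadElem e Z‖ ^ 2 ≤ K ^ 2 := by
    rcases (norm_nonneg (quadElem e Z)).eq_or_lt with h0 | h0
    · rw [← h0, zero_pow two_ne_zero]; positivity
    · have : ‖quadElem e Z‖ ≤ K := le_of_mul_le_mul_right (by linarith) h0
      gcongr
  calc ∑ k, ‖Z (f k)‖ ^ 2 = ∑ i, ∑ k, ‖(inner ℂ (f k) (Z (e i : V)) : ℂ)‖ ^ 2 := by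
        rw [Finset.sum_comm]
        refine Finset.sum_congr rfl fun k _ => ?_
        rw [norm_sq_eq_sum_inner_coe e (Submodule.subset_span (Or.inr ⟨k, rfl⟩) : Z (f k) ∈ M)]
        exact Finset.sum_congr rfl fun i _ => by rw [hZ]
    _ ≤ ∑ i, ‖compression e Z (e i : V)‖ ^ 2 := by
        refine Finset.sum_le_sum fun i _ => ?_
        have hk : ∀ k, (inner ℂ (f k) (Z (e i : V)) : ℂ) =
            inner ℂ (f k) (compression e Z (e i : V)) := fun k =>
          (inner_compression e Z _ (Submodule.subset_span (Or.inl ⟨k, rfl⟩) : f k ∈ M)).symm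
        simp only [hk]
        exact hf.sum_inner_products_le _
    _ ≤ 2 * K ^ 2 := by rw [← hS, ← h1]; gcongr

end Bounded

/-! ### Hilbert-Schmidt conditions -/

section HilbertSchmidt

variable {V : Type*} [NormedAddCommGroup V] [InnerProductSpace ℂ V]

/-- If `T` and `T'` are adjoint up to phases, then a Hilbert-Schmidt bound for `T'` in one basis
bounds `T` on every orthonormal family. -/
theorem hsBound_of_summable {T T' : V → V}
    (hT : ∀ x y, ‖(inner ℂ (T x) y : ℂ)‖ = ‖(inner ℂ (T' y) x : ℂ)‖) {s : Set V}
    (e : HilbertBasis s ℂ V) (hs : Summable fun i => ‖T' (e i)‖ ^ 2) :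
    HSBound T (∑' i, ‖T' (e i)‖ ^ 2) := by
  intro n f hf
  have h1 : ∀ x : V, HasSum (fun i => ‖(inner ℂ x (e i) : ℂ)‖ ^ 2) (‖x‖ ^ 2) := by
    intro x
    have h := e.hasSum_inner_mul_inner x x
    have hi : (fun i => (inner ℂ x (e i) * inner ℂ (e i) x : ℂ)) =
        fun i => ((‖(inner ℂ x (e i) : ℂ)‖ ^ 2 : ℝ) : ℂ) := funext fun i => by
      rw [← inner_conj_symm (e i) x, Complex.mul_conj, Complex.normSq_eq_norm_sq]
    have hx : (inner ℂ x x : ℂ) = ((‖x‖ ^ 2 : ℝ) : ℂ) := by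
      rw [inner_self_eq_norm_sq_to_K]
      push_cast
      rfl
    rw [hi, hx] at h
    exact Complex.hasSum_ofReal.1 h
  have h2 := hasSum_sum (s := Finset.univ) fun k _ => h1 (T (f k))
  refine hasSum_le (fun i => ?_) h2 hs.hasSum
  simp only [hT, norm_inner_symm (T' (e i))]
  exact hf.sum_inner_products_le _

theorem HSBound.summable {T : V → V} {h : ℝ} (hT : HSBound T h) {s : Set V}
    (e : HilbertBasis s ℂ V) : Summable fun i => ‖T (e i)‖ ^ 2 := by
  refine summable_of_sum_le (c := h) (fun i => sq_nonneg _) fun u => ?_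
  have := hT u.card (fun k => e (u.equivFin.symm k))
    (e.orthonormal.comp _ (Subtype.val_injective.comp u.equivFin.symm.injective))
  rw [u.equivFin.symm.sum_comp (fun i : u => ‖T (e i)‖ ^ 2)] at this
  rwa [← Finset.sum_coe_sort]

/-- The adjoint of the antilinear `A_g` is `-A_{g⁻¹}`. -/
theorem inner_aPart_inv (g : Symplectic V) (x y : V) :
    (inner ℂ (aPart g x) y : ℂ) = -inner ℂ (aPart g⁻¹ y) x := by
  have key : ∀ x y : V, (inner ℂ (aPart g x) y : ℂ).im = (-inner ℂ (aPart g⁻¹ y) x : ℂ).im := by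
    intro x y
    have h := g.2 x (((g⁻¹ : Symplectic V) : V ≃ₗ[ℝ] V) y)
    have h' : (g : V ≃ₗ[ℝ] V) (((g⁻¹ : Symplectic V) : V ≃ₗ[ℝ] V) y) = y :=
      (g : V ≃ₗ[ℝ] V).apply_symm_apply y
    rw [h', ← cPart_add_aPart, ← cPart_add_aPart, inner_add_left, inner_add_right,
      ← inner_cPart_inv, ← inner_conj_symm x (aPart g⁻¹ y), Complex.add_im, Complex.add_im,
      Complex.conj_im] at h
    rw [Complex.neg_im]
    exact add_left_cancel h
  refine Complex.ext ?_ (key x y)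
  have h := key x (Complex.I • y)
  simpa [inner_smul_right, inner_smul_left] using h

theorem norm_inner_aPart_inv (g : Symplectic V) (x y : V) :
    ‖(inner ℂ (aPart g⁻¹ x) y : ℂ)‖ = ‖(inner ℂ (aPart g y) x : ℂ)‖ := by
  rw [inner_aPart_inv g y x, norm_neg]

theorem norm_sq_aPart (g : Symplectic V) (x : V) :
    ‖aPart g x‖ ^ 2 = ‖cPart g x‖ ^ 2 - ‖x‖ ^ 2 := by
  have h := inner_c_sub_inner_a g x x
  simp only [inner_self_eq_norm_sq_to_K] at h
  have h' : ‖cPart g x‖ ^ 2 - ‖aPart g x‖ ^ 2 = ‖x‖ ^ 2 := by exact_mod_cast h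
  linarith

theorem IsHilbertSchmidt.exists_hsBound_inv {g : Symplectic V} (h : IsHilbertSchmidt (aPart g)) :
    ∃ b, HSBound (aPart g⁻¹) b := by
  obtain ⟨-, s, e, hs⟩ := h
  exact ⟨_, hsBound_of_summable (norm_inner_aPart_inv g) e hs⟩

variable [CompleteSpace V]

theorem exists_norm_cPart_le (g : Symplectic V) : ∃ K, 1 ≤ K ∧ ∀ x, ‖cPart g x‖ ≤ K * ‖x‖ := by
  have hcont : Continuous (cPart g) := by
    refine LinearMap.continuous_of_seq_closed_graph _ fun u x y hu hy => ?_
    refine ext_inner_right ℂ fun z => ?_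
    rw [inner_cPart_inv]
    refine tendsto_nhds_unique (hy.inner (tendsto_const_nhds (x := z))) ?_
    refine ((hu.inner (tendsto_const_nhds (x := cPart g⁻¹ z)))).congr fun n => ?_
    rw [← inner_cPart_inv]; rfl
  let C : V →L[ℂ] V := ⟨cPart g, hcont⟩
  refine ⟨max 1 ‖C‖, le_max_left _ _, fun x => (C.le_opNorm x).trans ?_⟩
  gcongr
  exact le_max_right _ _

theorem continuous_aPart (g : Symplectic V) : Continuous (aPart g) := by
  obtain ⟨K, hK1, hK⟩ := exists_norm_cPart_le g
  refine AddMonoidHomClass.continuous_of_bound (aPart g) K fun x => ?_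
  refine le_trans (le_of_sq_le_sq ?_ (norm_nonneg _)) (hK x)
  rw [norm_sq_aPart]
  linarith [sq_nonneg ‖x‖]

/-- As `C_{g⁻¹}` is the adjoint of `C_g`, this says that `Z_g` equals its own adjoint
`-(C_g⁻¹)* A_g*`; it makes `Z_g` comparable with `A_{g⁻¹}`. -/
theorem cPart_inv_zOp (g : Symplectic V) (y : V) : cPart g⁻¹ (zOp g y) = aPart g⁻¹ y := by
  obtain ⟨u, rfl⟩ := (cPart_bijective g).surjective y
  have h := (parts_comp_inv g⁻¹ u).2
  rw [inv_inv] at h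
  rw [zOp_cPart, map_neg]
  exact neg_eq_of_add_eq_zero_right h

theorem isHilbertSchmidt_of_hsBound_inv {g : Symplectic V} {b : ℝ} (h : HSBound (aPart g⁻¹) b) :
    IsHilbertSchmidt (aPart g) := by
  obtain ⟨s, e, -⟩ := exists_hilbertBasis ℂ V
  have h' : HSBound (aPart g) _ :=
    hsBound_of_summable (fun x y => (norm_inner_aPart_inv g y x).symm) e (h.summable e)
  exact ⟨continuous_aPart g, s, e, h'.summable e⟩

theorem IsHilbertSchmidt.inv {g : Symplectic V} (h : IsHilbertSchmidt (aPart g)) :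
    IsHilbertSchmidt (aPart g⁻¹) := by
  obtain ⟨-, s, e, hs⟩ := h
  have h' := hsBound_of_summable (norm_inner_aPart_inv g) e hs
  exact ⟨continuous_aPart g⁻¹, s, e, h'.summable e⟩

theorem IsHilbertSchmidt.exists_hsBound_zOp {g : Symplectic V}
    (h : IsHilbertSchmidt (aPart g)) : ∃ b, HSBound (zOp g) b := by
  obtain ⟨b, hb⟩ := h.exists_hsBound_inv
  refine ⟨b, fun n f hf => le_trans (Finset.sum_le_sum fun i _ => ?_) (hb n f hf)⟩
  rw [← cPart_inv_zOp]
  gcongr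
  exact norm_le_norm_cPart g⁻¹ _

theorem isHilbertSchmidt_of_hsBound_zOp {g : Symplectic V} {b : ℝ} (h : HSBound (zOp g) b) :
    IsHilbertSchmidt (aPart g) := by
  obtain ⟨K, -, hK⟩ := exists_norm_cPart_le g⁻¹
  refine isHilbertSchmidt_of_hsBound_inv (b := K ^ 2 * b) fun n f hf => ?_
  calc ∑ i, ‖aPart g⁻¹ (f i)‖ ^ 2 ≤ ∑ i, K ^ 2 * ‖zOp g (f i)‖ ^ 2 := by
        refine Finset.sum_le_sum fun i _ => ?_
        rw [← cPart_inv_zOp, ← mul_pow]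
        gcongr
        exact hK _
    _ ≤ K ^ 2 * b := by
        rw [← Finset.mul_sum]
        gcongr
        exact h n f hf

/-- `Z_g` is a strict contraction: `‖Z_g C_g u‖² = ‖C_g u‖² - ‖u‖²`, and `C_g` is bounded. -/
theorem exists_norm_zOp_le (g : Symplectic V) :
    ∃ t : ℝ, 0 ≤ t ∧ t < 1 ∧ ∀ x, ‖zOp g x‖ ≤ t * ‖x‖ := by
  obtain ⟨K, hK1, hK⟩ := exists_norm_cPart_le g
  have hK2 : 0 < (K ^ 2)⁻¹ := by positivity
  have hK3 : (K ^ 2)⁻¹ ≤ 1 := inv_le_one_of_one_le₀ (one_le_pow₀ hK1)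
  refine ⟨√(1 - (K ^ 2)⁻¹), Real.sqrt_nonneg _, ?_, fun x => ?_⟩
  · rw [Real.sqrt_lt' one_pos]; linarith
  · obtain ⟨u, rfl⟩ := (cPart_bijective g).surjective x
    refine le_of_sq_le_sq ?_ (by positivity)
    rw [zOp_cPart, norm_neg, norm_sq_aPart, mul_pow, Real.sq_sqrt (by linarith), sub_mul, one_mul]
    have h : (K ^ 2)⁻¹ * ‖cPart g u‖ ^ 2 ≤ ‖u‖ ^ 2 := by
      rw [inv_mul_le_iff₀ (by positivity), ← mul_pow]
      gcongr
      exact hK u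
    linarith

end HilbertSchmidt

/-! ### Unitary implementation -/

section Implementation

variable {V : Type*} [NormedAddCommGroup V] [InnerProductSpace ℂ V]

theorem fock_ext {Φ Ψ : Fock V} (h : (Φ : AntiDual V) = Ψ) : Φ = Ψ :=
  ContinuousLinearMap.coe_injective h

theorem fieldOp_apply (v : V) (Φ : AntiDual V) (ψ : Sym V) :
    fieldOp v Φ ψ = ((√2 : ℝ) : ℂ)⁻¹ * (Φ (annihilator v ψ) + Φ (inc v * ψ)) := rfl

theorem Extends.unique {U U' : Fock V ≃ₗᵢ[ℂ] Fock V} {T : Sym V →ₗ[ℂ] AntiDual V}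
    (h : Extends U T) (h' : Extends U' T) : U = U' := by
  have : (U : Fock V → Fock V) = U' :=
    denseRange_toFock.equalizer U.continuous U'.continuous
      (funext fun ψ => fock_ext ((h ψ).trans (h' ψ).symm))
  exact LinearIsometryEquiv.ext fun Φ => congrFun this Φ

variable [CompleteSpace V]

theorem IsHilbertSchmidt.isAnalytic_implementer {g : Symplectic V}
    (h : IsHilbertSchmidt (aPart g)) (ψ : Sym V) : IsAnalytic (implementer g ψ) := by
  induction ψ using sym_induction with
  | one =>
    obtain ⟨t, ht0, ht1, ht⟩ := exists_norm_zOp_le g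
    obtain ⟨b, hb⟩ := h.exists_hsBound_zOp
    rw [implementer_one]
    exact isAnalytic_gaussian _ (zOp_symm g) ht0 ht1 ht hb
  | smul c a ha => rw [map_smul]; exact ha.smul c
  | add a b ha hb => rw [map_add]; exact ha.add hb
  | mul v a ha =>
    rw [implementer_inc_mul]
    convert ha.antiAnnihilator_add_antiCreator (aPart g v) (cPart g v) using 1
    rw [add_comm]
    rfl

/-- For Hilbert-Schmidt `A_g` the map `U_g` takes values in Fock space. -/
theorem IsHilbertSchmidt.exists_fockImplementer {g : Symplectic V}
    (h : IsHilbertSchmidt (aPart g)) :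
    ∃ F : Sym V →ₗ[ℂ] Fock V, ∀ ψ, (F ψ : AntiDual V) = implementer g ψ := by
  choose f hf using fun ψ => (h.isAnalytic_implementer ψ).exists_fock
  refine ⟨{ toFun := f, map_add' := fun a b => ?_, map_smul' := fun c a => ?_ }, hf⟩
  · apply fock_ext
    rw [ContinuousLinearMap.toLinearMap_add, hf, hf, hf, map_add]
  · apply fock_ext
    rw [RingHom.id_apply, ContinuousLinearMap.toLinearMap_smul, hf, hf, map_smul]

/-- Up to the factor `‖e^Z‖²` the map `U_g` is isometric: it turns the adjoint pair `c(v)`, `a(v)`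
into the adjoint pair `c(C_g v) + a(A_g v)`, `a(C_g v) + c(A_g v)`. -/
theorem IsHilbertSchmidt.inner_fockImplementer {g : Symplectic V}
    (h : IsHilbertSchmidt (aPart g)) {F : Sym V →ₗ[ℂ] Fock V}
    (hF : ∀ ψ, (F ψ : AntiDual V) = implementer g ψ) (φ ψ : Sym V) :
    (inner ℂ (F φ) (F ψ) : ℂ) = inner ℂ (F 1) (F 1) * inner ℂ φ ψ := by
  have hF' : ∀ ψ θ, F ψ θ = implementer g ψ θ := fun ψ θ => LinearMap.congr_fun (hF ψ) θ
  have key : ∀ (v : V) (φ ψ : Sym V),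
      (inner ℂ (F (inc v * φ)) (F ψ) : ℂ) = inner ℂ (F φ) (F (annihilator v ψ)) := by
    intro v φ ψ
    refine IsAnalytic.inner_eq ?_ (aPart g v) (cPart g v) (fun θ => ?_) (fun θ => ?_)
    · rw [hF]; exact h.isAnalytic_implementer φ
    · rw [hF', hF', hF', implementer_inc_mul_apply, add_comm]
    · rw [hF', hF', hF', implementer_annihilator_apply, add_comm]
  induction φ using sym_induction generalizing ψ with
  | one =>
    induction ψ using sym_induction with
    | one => simp [norm_one_sym]
    | smul c a ha =>
      rw [map_smul, fock_inner_smul_right, inner_smul_right, ha]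
      ring
    | add a b ha hb => simp only [map_add, inner_add_right, ha, hb]; ring
    | mul v a ha =>
      rw [← inner_conj_symm, key, ← inner_annihilator]
      simp
  | smul c a ha =>
    rw [map_smul, fock_inner_smul_left, inner_smul_left, ha]
    ring
  | add a b ha hb => simp only [map_add, inner_add_left, ha, hb]; ring
  | mul v a ha => rw [key, ha, inner_inc_mul]

/-- The normalized `U_g` extends from the dense subspace `SV` to an isometry of Fock space. -/
theorem IsHilbertSchmidt.exists_isometry {g : Symplectic V} (h : IsHilbertSchmidt (aPart g)) :
    ∃ (Γ : Fock V) (T : Fock V →ₗᵢ[ℂ] Fock V), (Γ : AntiDual V) = gaussian (zOp g) ∧ ‖Γ‖ ≠ 0 ∧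
      ∀ ψ, ((T (toFock ψ) : Fock V) : AntiDual V) = ((‖Γ‖⁻¹ : ℝ) : ℂ) • implementer g ψ := by
  obtain ⟨F, hF⟩ := h.exists_fockImplementer
  have h1 : (F 1 : AntiDual V) = gaussian (zOp g) := by rw [hF, implementer_one]
  have h0 : ‖F 1‖ ≠ 0 := by
    intro h0
    have h2 := LinearMap.congr_fun h1 1
    rw [norm_eq_zero.1 h0, gaussian_one] at h2
    exact zero_ne_one h2
  let L : Sym V →ₗ[ℂ] Fock V := ((‖F 1‖⁻¹ : ℝ) : ℂ) • F
  have hL : ∀ ψ, L ψ = ((‖F 1‖⁻¹ : ℝ) : ℂ) • F ψ := fun _ => rfl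
  have hLn : ∀ ψ, ‖L ψ‖ = ‖ψ‖ := by
    intro ψ
    have h2 := h.inner_fockImplementer hF ψ ψ
    simp only [inner_self_eq_norm_sq_to_K] at h2
    have h3 : ‖F ψ‖ ^ 2 = (‖F 1‖ * ‖ψ‖) ^ 2 := by
      rw [mul_pow]
      exact_mod_cast h2
    have h4 : ‖F ψ‖ = ‖F 1‖ * ‖ψ‖ := (sq_eq_sq₀ (norm_nonneg _) (by positivity)).1 h3
    rw [hL, norm_smul, h4, Complex.norm_real, norm_inv, norm_norm, inv_mul_cancel_left₀ h0]
  let Lc : Sym V →L[ℂ] Fock V := L.mkContinuous 1 fun ψ => by rw [hLn, one_mul]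
  let T : Fock V →L[ℂ] Fock V := Lc.extend (innerSLFlip ℂ)
  have hT : ∀ ψ, T (toFock ψ) = L ψ := fun ψ =>
    Lc.extend_eq (e := innerSLFlip ℂ) denseRange_toFock isometry_toFock.isUniformInducing ψ
  have hTn : ∀ Φ, ‖T Φ‖ = ‖Φ‖ := fun Φ =>
    denseRange_toFock.induction_on (p := fun Φ => ‖T Φ‖ = ‖Φ‖) Φ
      (isClosed_eq T.continuous.norm continuous_norm)
      fun ψ => by rw [hT, hLn, norm_toFock]
  refine ⟨F 1, ⟨T.toLinearMap, hTn⟩, h1, h0, fun ψ => ?_⟩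
  change ((T (toFock ψ) : Fock V) : AntiDual V) = _
  rw [hT, hL, ContinuousLinearMap.toLinearMap_smul, hF]

/-- The normalized `U_g` extends to a unitary operator: the isometries extending `U_g` and `U_{g⁻¹}`
are adjoint to each other up to a nonzero factor, so the range of the first is everything. -/
theorem IsHilbertSchmidt.exists_unitary {g : Symplectic V} (h : IsHilbertSchmidt (aPart g)) :
    ∃ (Γ : Fock V) (U : Fock V ≃ₗᵢ[ℂ] Fock V), (Γ : AntiDual V) = gaussian (zOp g) ∧
      Extends U (((‖Γ‖⁻¹ : ℝ) : ℂ) • implementer g) := by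
  obtain ⟨Γ, T, hΓ, h0, hT⟩ := h.exists_isometry
  obtain ⟨Γ', T', -, h0', hT'⟩ := h.inv.exists_isometry
  have hTa : ∀ ψ θ, T (toFock ψ) θ = ((‖Γ‖⁻¹ : ℝ) : ℂ) * implementer g ψ θ :=
    fun ψ θ => LinearMap.congr_fun (hT ψ) θ
  have hTa' : ∀ ψ θ, T' (toFock ψ) θ = ((‖Γ'‖⁻¹ : ℝ) : ℂ) * implementer g⁻¹ ψ θ :=
    fun ψ θ => LinearMap.congr_fun (hT' ψ) θ
  have hadj : ∀ (ψ : Sym V) (Φ : Fock V), ((‖Γ‖⁻¹ : ℝ) : ℂ) * inner ℂ (toFock ψ) (T' Φ) =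
      ((‖Γ'‖⁻¹ : ℝ) : ℂ) * inner ℂ (T (toFock ψ)) Φ := by
    intro ψ Φ
    refine denseRange_toFock.induction_on (p := fun Φ => ((‖Γ‖⁻¹ : ℝ) : ℂ) *
      inner ℂ (toFock ψ) (T' Φ) = ((‖Γ'‖⁻¹ : ℝ) : ℂ) * inner ℂ (T (toFock ψ)) Φ) Φ ?_ ?_
    · exact isClosed_eq (continuous_const.mul (continuous_const.inner T'.continuous))
        (continuous_const.mul (continuous_const.inner continuous_id))
    · intro φ
      rw [inner_toFock, inner_toFock_right, hTa, hTa', implementer_inv_apply, map_mul,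
        Complex.conj_ofReal]
      ring
  have hsurj : Function.Surjective T := by
    have hcl : IsClosed ((LinearMap.range T.toLinearMap : Submodule ℂ (Fock V)) : Set (Fock V)) :=
      T.isometry.isClosedEmbedding.isClosed_range
    have : CompleteSpace (LinearMap.range T.toLinearMap) := hcl.completeSpace_coe
    have htop : LinearMap.range T.toLinearMap = ⊤ := by
      rw [← Submodule.orthogonal_eq_bot_iff, Submodule.eq_bot_iff]
      intro Φ hΦ
      have hz : T' Φ = 0 := by
        ext ψ
        have h1 := hadj ψ Φ
        have h2 : (inner ℂ (T (toFock ψ)) Φ : ℂ) = 0 := hΦ _ ⟨toFock ψ, rfl⟩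
        rw [h2, mul_zero, inner_toFock] at h1
        exact (mul_eq_zero.1 h1).resolve_left (by exact_mod_cast inv_ne_zero h0)
      rw [← norm_eq_zero, ← T'.norm_map, hz, norm_zero]
    exact LinearMap.range_eq_top.1 htop
  exact ⟨Γ, LinearIsometryEquiv.ofSurjective T hsurj, hΓ, hT⟩

theorem Extends.symm {g : Symplectic V} {U : Fock V ≃ₗᵢ[ℂ] Fock V} {r : ℂ}
    (h : Extends U (r • implementer g)) : Extends U.symm (conj r • implementer g⁻¹) := by
  intro ψ
  ext φ
  have h1 : U (toFock φ) ψ = r * implementer g φ ψ := LinearMap.congr_fun (h φ) ψ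
  calc U.symm (toFock ψ) φ = inner ℂ (toFock φ) (U.symm (toFock ψ)) := (inner_toFock _ _).symm
    _ = inner ℂ (U (toFock φ)) (toFock ψ) := by
        rw [← U.inner_map_map, U.apply_symm_apply]
    _ = conj r * implementer g⁻¹ ψ φ := by
        rw [inner_toFock_right, h1, map_mul, implementer_inv_apply]

theorem implementer_field_apply (g : Symplectic V) (v : V) (ψ θ : Sym V) :
    implementer g (inc v * ψ + annihilator v ψ) θ =
      implementer g ψ (inc ((g : V ≃ₗ[ℝ] V) v) * θ) +
        implementer g ψ (annihilator ((g : V ≃ₗ[ℝ] V) v) θ) := by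
  rw [map_add, LinearMap.add_apply, implementer_inc_mul_apply, implementer_annihilator_apply,
    ← cPart_add_aPart]
  simp only [annihilator_add, map_add, add_mul]
  ring

/-- A unitary extension of a multiple of `U_g` carries `π(v)Φ = Ψ` to `π(gv)UΦ = UΨ`, for any `Φ`
and `Ψ` in Fock space. Tested on `ψ` in `SV` this concerns the vector `U⁻¹ψ`, which need not lie in
`SV` but is analytic. -/
theorem Extends.map_fieldOp {g : Symplectic V} (hg : IsHilbertSchmidt (aPart g⁻¹))
    {U : Fock V ≃ₗᵢ[ℂ] Fock V} {r : ℂ} (h : Extends U (r • implementer g)) {v : V} {Φ Ψ : Fock V}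
    (hΨ : (Ψ : AntiDual V) = fieldOp v (Φ : AntiDual V)) :
    ((U Ψ : Fock V) : AntiDual V) =
      fieldOp ((g : V ≃ₗ[ℝ] V) v) ((U Φ : Fock V) : AntiDual V) := by
  have hs : ((√2 : ℝ) : ℂ) ≠ 0 := by
    exact_mod_cast (Real.sqrt_pos.2 two_pos).ne'
  have hsymm : ∀ ψ θ, U.symm (toFock ψ) θ = conj r * implementer g⁻¹ ψ θ :=
    fun ψ θ => LinearMap.congr_fun (h.symm ψ) θ
  have hmove : ∀ (ψ : Sym V) (Θ : Fock V), U Θ ψ = inner ℂ (U.symm (toFock ψ)) Θ := by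
    intro ψ Θ
    rw [← inner_toFock, ← U.inner_map_map (U.symm (toFock ψ)), U.apply_symm_apply]
  have hg' : ((g⁻¹ : Symplectic V) : V ≃ₗ[ℝ] V) ((g : V ≃ₗ[ℝ] V) v) = v :=
    (g : V ≃ₗ[ℝ] V).symm_apply_apply v
  ext ψ
  have key := IsAnalytic.inner_eq (Φ := U.symm (toFock ψ))
    (Φ₁ := U.symm (toFock (inc ((g : V ≃ₗ[ℝ] V) v) * ψ + annihilator ((g : V ≃ₗ[ℝ] V) v) ψ)))
    (Ψ := Φ) (Ψ₁ := ((√2 : ℝ) : ℂ) • Ψ) (by rw [h.symm]; exact (hg.isAnalytic_implementer ψ).smul _)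
    v v (fun θ => by rw [hsymm, hsymm, hsymm, implementer_field_apply, hg', mul_add])
    (fun θ => by
      have := LinearMap.congr_fun hΨ θ
      rw [fieldOp_apply] at this
      change ((√2 : ℝ) : ℂ) * Ψ θ = _
      change Ψ θ = _ at this
      rw [this, mul_inv_cancel_left₀ hs]
      rfl)
  rw [← hmove, fock_inner_smul_right, ← hmove] at key
  rw [fieldOp_apply]
  change U Ψ ψ = _ * (U Φ _ + U Φ _)
  rw [← map_add, add_comm (annihilator _ ψ), key, inv_mul_cancel_left₀ hs]

theorem Extends.implements {g : Symplectic V} (hg : IsHilbertSchmidt (aPart g))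
    {U : Fock V ≃ₗᵢ[ℂ] Fock V} {r : ℂ} (h : Extends U (r • implementer g)) : Implements U g := by
  intro v
  refine ⟨fun Φ => ⟨?_, ?_⟩, fun Φ Ψ hΨ => h.map_fieldOp hg.inv hΨ⟩
  · rintro ⟨Ψ, hΨ⟩
    exact ⟨U Ψ, h.map_fieldOp hg.inv hΨ⟩
  · rintro ⟨Ψ, hΨ⟩
    have h1 := h.symm.map_fieldOp (by rwa [inv_inv]) hΨ
    have hg' : ((g⁻¹ : Symplectic V) : V ≃ₗ[ℝ] V) ((g : V ≃ₗ[ℝ] V) v) = v :=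
      (g : V ≃ₗ[ℝ] V).symm_apply_apply v
    rw [hg', U.symm_apply_apply] at h1
    exact ⟨U.symm Ψ, h1⟩

theorem isHilbertSchmidt_of_extends {g : Symplectic V} {c : ℂ} {U : Fock V ≃ₗᵢ[ℂ] Fock V}
    (h : Extends U (c • implementer g)) : IsHilbertSchmidt (aPart g) := by
  have h1 : ∀ ψ, U (toFock 1) ψ = c * gaussian (zOp g) ψ := fun ψ => by
    have := LinearMap.congr_fun (h 1) ψ
    rwa [LinearMap.smul_apply, implementer_one] at this
  have hc : c ≠ 0 := by
    rintro rfl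
    have h2 : U (toFock 1) = 0 := by
      ext ψ
      rw [h1, zero_mul]
      rfl
    have h3 := U.norm_map (toFock 1)
    rw [h2, norm_zero, norm_toFock, norm_one_sym] at h3
    exact zero_ne_one h3
  refine isHilbertSchmidt_of_hsBound_zOp (hsBound_of_norm_gaussian_le (zOp g) (zOp_symm g)
    (K := ‖c‖⁻¹ * ‖U (toFock 1)‖) fun ψ => ?_)
  have h2 := (U (toFock 1)).le_opNorm ψ
  rw [h1, norm_mul] at h2
  rwa [mul_assoc, le_inv_mul_iff₀ (norm_pos_iff.2 hc)]

end Implementation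

end BosonicFock

end

theorem mainTheorem2 {V : Type*} [NormedAddCommGroup V] [InnerProductSpace ℂ V] [CompleteSpace V]
    (g : Symplectic V) :
    (IsHilbertSchmidt (aPart g) →
      ∃ Γ : Fock V, (Γ : AntiDual V) = gaussian (zOp g) ∧
        (∃! U : Fock V ≃ₗᵢ[ℂ] Fock V, Extends U (((‖Γ‖⁻¹ : ℝ) : ℂ) • implementer g)) ∧
        ∀ U : Fock V ≃ₗᵢ[ℂ] Fock V, Extends U (((‖Γ‖⁻¹ : ℝ) : ℂ) • implementer g) →
          Implements U g) ∧
    ((∃ (c : ℂ) (U : Fock V ≃ₗᵢ[ℂ] Fock V), Extends U (c • implementer g)) →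
      IsHilbertSchmidt (aPart g)) := by
  refine ⟨fun h => ?_, fun ⟨c, U, hU⟩ => isHilbertSchmidt_of_extends hU⟩
  obtain ⟨Γ, U, hΓ, hU⟩ := h.exists_unitary
  exact ⟨Γ, hΓ, ⟨U, hU, fun U' hU' => Extends.unique hU' hU⟩, fun U' hU' => hU'.implements h⟩
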